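/- Let $\Gamma$ be the star graph consisting of $N\ge 2$ half-lines $[0,\infty)$ joined at their origins. A function on $\Gamma$ is $u=(u_e)_{e=1}^N$ with $u_e:[0,\infty)\to\mathbb{C}$, and $H^1(\Gamma)$ is the set of those $u$ whose components are continuous on $[0,\infty)$, belong to $H^1(0,\infty)$, and satisfy $u_1(0)=\dots=u_N(0)$. Write $\|u\|_p^p=\sum_{e}\int_0^\infty|u_e|^p\,dx$ and $u'=(u_e')_e$, $uv=(u_ev_e)_e$. Let $a,b,c\in\mathbb{R}$ satisfy either $0<b<\min\{a,c\}$, or $a,c>0$ and $b>\max\{a,c\}$. Let $\gamma>0$, $\omega>\gamma^2/N^2$ and $N\sqrt\omega-\gamma\le 2\gamma/N$. For $u,v\in H^1(\Gamma)$ put $$E(u,v)=\|u'\|_2^2+\|v'\|_2^2-\gamma\left(|u_1(0)|^2+|v_1(0)|^2\right)-\tfrac12\left(a\|u\|_4^4+c\|v\|_4^4\right)-b\|uv\|_2^2,$$ $$\alpha=\frac{2(b-c)}{b^2-ac}(N\sqrt\omega-\gamma),\qquad \beta=\frac{2(b-a)}{b^2-ac}(N\sqrt\omega-\gamma),$$ $$J(\alpha,\beta)=\inf\{E(u,v):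 u,v\in H^1(\Gamma),\ \|u\|_2^2=\alpha,\ \|v\|_2^2=\beta\}.$$ Then the set of ground states $$\mathcal G(\alpha,\beta)=\{(u,v)\in H^1(\Gamma)\times H^1(\Gamma): E(u,v)=J(\alpha,\beta),\ \|u\|_2^2=\alpha,\ \|v\|_2^2=\beta\}$$ is given by $$\mathcal G(\alpha,\beta)=\left\{\left(e^{i\theta_1}\sqrt{\tfrac{b-c}{b^2-ac}}\;\Phi_{\omega,\gamma},\ e^{i\theta_2}\sqrt{\tfrac{b-a}{b^2-ac}}\;\Phi_{\omega,\gamma}\right):\theta_1,\theta_2\in\mathbb{R}\right\},$$ where every component of $\Phi_{\omega,\gamma}$ equals $$\phi_{\omega,\gamma}(x)=\sqrt{2\omega}\,\operatorname{sech}\left(\sqrt\omega\,x+\tanh^{-1}\left(\frac{\gamma}{N\sqrt\omega}\right)\right),\qquad x\ge 0.$$ -/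

import Mathlib

open Set MeasureTheory
open scoped NNReal

noncomputable section

namespace StarGraph

/-- Lebesgue measure on the open half-line `(0, ∞)`. -/
abbrev halfLine : Measure ℝ := volume.restrict (Ioi (0 : ℝ))

/-- A function on the closed half-line `[0, ∞)` read as a function of a real variable; only its
values on `(0, ∞)` are ever used. -/
def onHalfLine (f : ℝ≥0 → ℂ) : ℝ → ℂ := fun x => f x.toNNReal

/-- `g` is a weak derivative of `f` on `(0, ∞)`: integration by parts holds against every smooth
test function with compact support inside `(0, ∞)`. -/
def IsWeakDeriv (f g : ℝ → ℂ) : Prop :=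
  ∀ φ : ℝ → ℝ, ContDiff ℝ (⊤ : ℕ∞) φ → HasCompactSupport φ → tsupport φ ⊆ Ioi (0 : ℝ) →
    ∫ x in Ioi (0 : ℝ), ((deriv φ x : ℝ) : ℂ) * f x = -∫ x in Ioi (0 : ℝ), (φ x : ℂ) * g x

/-- `g ∈ L²(0, ∞)` is a weak derivative of `f`. -/
def HasL2WeakDeriv (f g : ℝ → ℂ) : Prop :=
  MemLp g 2 halfLine ∧ IsWeakDeriv f g

open Classical in
/-- The weak derivative of `f` in `L²(0, ∞)` (unique almost everywhere when it exists, and `0` by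
convention when it does not exist). -/
def weakDeriv (f : ℝ → ℂ) : ℝ → ℂ :=
  if h : ∃ g, HasL2WeakDeriv f g then h.choose else 0

/-- The Sobolev space `H¹(ℝ⁺)`. -/
def MemH1HalfLine (f : ℝ → ℂ) : Prop :=
  MemLp f 2 halfLine ∧ ∃ g, HasL2WeakDeriv f g

/-- Complex functions on the star graph made of `N` half-lines `[0, ∞)` glued at their origins:
one component `u e` for each edge `e`. -/
abbrev Fun (N : ℕ) : Type := Fin N → ℝ≥0 → ℂ

/-- The space `C(Γ)`: each component is continuous on `[0, ∞)` and all components have the same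
value at the vertex. -/
def IsContinuous {N : ℕ} (u : Fun N) : Prop :=
  (∀ e, Continuous (u e)) ∧ ∀ e e', u e 0 = u e' 0

/-- The Sobolev space `H¹(Γ)`. -/
def MemH1 {N : ℕ} (u : Fun N) : Prop :=
  IsContinuous u ∧ ∀ e, MemH1HalfLine (onHalfLine (u e))

/-- `‖u‖₂²`, the mass `Q(u)`. -/
def mass {N : ℕ} (u : Fun N) : ℝ :=
  ∑ e, ∫ x in Ioi (0 : ℝ), ‖onHalfLine (u e) x‖ ^ 2

/-- `‖u'‖₂²`. -/
def kinetic {N : ℕ} (u : Fun N) : ℝ :=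
  ∑ e, ∫ x in Ioi (0 : ℝ), ‖weakDeriv (onHalfLine (u e)) x‖ ^ 2

/-- `‖u‖₄⁴`. -/
def quartic {N : ℕ} (u : Fun N) : ℝ :=
  ∑ e, ∫ x in Ioi (0 : ℝ), ‖onHalfLine (u e) x‖ ^ 4

/-- `‖u v‖₂²`. -/
def interaction {N : ℕ} (u v : Fun N) : ℝ :=
  ∑ e, ∫ x in Ioi (0 : ℝ), ‖onHalfLine (u e) x * onHalfLine (v e) x‖ ^ 2

/-- The energy of the coupled cubic system with `δ` coupling of strength `γ` at the vertex. -/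
def energy {N : ℕ} [NeZero N] (γ a b c : ℝ) (u v : Fun N) : ℝ :=
  kinetic u + kinetic v - γ * (‖u 0 0‖ ^ 2 + ‖v 0 0‖ ^ 2)
    - (1 / 2) * (a * quartic u + c * quartic v) - b * interaction u v

/-- Pairs in `H¹(Γ) × H¹(Γ)` with masses `α` and `β`. -/
def admissible (N : ℕ) (α β : ℝ) : Set (Fun N × Fun N) :=
  {p | MemH1 p.1 ∧ MemH1 p.2 ∧ mass p.1 = α ∧ mass p.2 = β}

/-- The infimum `J(α, β)` of the energy over the admissible pairs, taken in the extended reals so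
that it is a true infimum in all cases. -/
def minEnergy (N : ℕ) [NeZero N] (γ a b c α β : ℝ) : EReal :=
  sInf ((fun p : Fun N × Fun N => (energy γ a b c p.1 p.2 : EReal)) '' admissible N α β)

/-- The set `𝒢(α, β)` of ground states. -/
def groundStates (N : ℕ) [NeZero N] (γ a b c α β : ℝ) : Set (Fun N × Fun N) :=
  {p | p ∈ admissible N α β ∧ (energy γ a b c p.1 p.2 : EReal) = minEnergy N γ a b c α β}

/-- The mass `α(ω)` of the first component. -/
def alphaMass (N : ℕ) (γ ω a b c : ℝ) : ℝ :=
  2 * (b - c) / (b ^ 2 - a * c) * (N * √ω - γ)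

/-- The mass `β(ω)` of the second component. -/
def betaMass (N : ℕ) (γ ω a b c : ℝ) : ℝ :=
  2 * (b - a) / (b ^ 2 - a * c) * (N * √ω - γ)

/-- The hyperbolic secant. -/
def sech (x : ℝ) : ℝ := 1 / Real.cosh x

/-- The scalar profile
`√(2ω) sech(√ω x + tanh⁻¹(γ / (N √ω)))`. -/
def profile (N : ℕ) (γ ω x : ℝ) : ℝ :=
  √(2 * ω) * sech (√ω * x + Real.artanh (γ / (N * √ω)))

/-- The function on the graph whose components all equal `A` times the scalar profile. -/
def scaledProfile (N : ℕ) (γ ω : ℝ) (A : ℂ) : Fun N :=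
  fun _ x => A * (profile N γ ω x : ℂ)

end StarGraph

end

namespace StarGraph

open Filter Topology

/-! ### Absolutely continuous functions -/

/-! The coupled problem splits into two copies of one scalar problem. The numbers A = (b-c)/(b²-ac)
and B = (b-a)/(b²-ac) are positive and solve aA + bB = bA + cB = 1. For u = √A U and v = √B V, the
energy equals A·S(U) + B·S(V) + bAB((‖U‖₄⁴ + ‖V‖₄⁴)/2 - ‖UV‖₂²), where S is the scalar energy
(`energy_scale`). The last term is nonnegative and vanishes for U = V (`interaction_le`,
`interaction_self`). U and V carry the same mass Nn with n = 2(√ω - γ/N), so it suffices to know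
that the minimizers of S at that mass are the phase multiples of Φ.

The scalar problem is solved by completing a square. On an edge of mass μ put l = √ω and w(x) = l -
½∫_x^∞ |f|², so that w' = |f|²/2 and w → l. Then |f' + wf|² - |f'|² + ½|f|⁴ is the derivative of
w|f|² + ⅔w³, which gives `IsH1Pair.energy_identity`. Summed over the edges, the vertex terms cancel
the δ term exactly, because the total mass is Nn and γ = N(l - n/2). What remains is a cubic in each
edge mass; expanded at n, its linear part sums to zero and the rest is a multiple of (μ - n)²
(`scalarEnergy_eq`). The bound on N√ω - γ serves to make that multiple positive (`coefficient_pos`).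

At equality every edge has mass n and f' = -wf. Then w² + |f|²/2 = l² is conserved, so w = l tanh(lx
+ t) with l tanh t = γ/N, and f cosh(lx + t) is constant
(`IsH1Pair.eq_profile_of_integral_eq_zero`). Continuity at the vertex leaves a single phase for all
edges. The weak derivatives are made accessible to this calculus by the du Bois-Reymond lemma, which
turns members of H¹ into primitives. -/

theorem absolutelyContinuousOnInterval_const {F : Type*} [NormedAddCommGroup F]
    [NormedSpace ℝ F] (c : F) (a b : ℝ) :
    AbsolutelyContinuousOnInterval (fun _ : ℝ => c) a b :=
  (contDiff_const.contDiffOn).absolutelyContinuousOnInterval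

theorem _root_.AbsolutelyContinuousOnInterval.congr_of_eqOn {F : Type*} [PseudoMetricSpace F]
    {f g : ℝ → F} {a b : ℝ} (hf : AbsolutelyContinuousOnInterval f a b)
    (h : EqOn f g (uIcc a b)) : AbsolutelyContinuousOnInterval g a b := by
  rw [absolutelyContinuousOnInterval_iff] at hf ⊢
  intro ε hε
  obtain ⟨δ, hδ, H⟩ := hf ε hε
  refine ⟨δ, hδ, fun E hE hE' => ?_⟩
  have := H E hE hE'
  rwa [Finset.sum_congr rfl fun i hi => by rw [h (hE.1 i hi).1, h (hE.1 i hi).2]] at this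

/-- The real and imaginary parts of the primitive are primitives of real functions; they are
recombined with the constants 1 and I. -/
theorem absolutelyContinuousOnInterval_primitive {g : ℝ → ℂ} {X : ℝ}
    (hg : IntervalIntegrable g volume 0 X) :
    AbsolutelyContinuousOnInterval (fun x => ∫ t in (0 : ℝ)..x, g t) 0 X := by
  have hre : IntervalIntegrable (fun t => (g t).re) volume 0 X := ⟨hg.1.re, hg.2.re⟩
  have him : IntervalIntegrable (fun t => (g t).im) volume 0 X := ⟨hg.1.im, hg.2.im⟩
  have h1 := (hre.absolutelyContinuousOnInterval_intervalIntegral (c := 0) (by simp)).fun_smul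
    (absolutelyContinuousOnInterval_const (1 : ℂ) 0 X)
  have h2 := (him.absolutelyContinuousOnInterval_intervalIntegral (c := 0) (by simp)).fun_smul
    (absolutelyContinuousOnInterval_const Complex.I 0 X)
  refine (h1.fun_add h2).congr_of_eqOn fun x hx => ?_
  have hi : IntervalIntegrable g volume 0 x := hg.mono_set (uIcc_subset_uIcc_left hx)
  have e1 : ∫ t in (0 : ℝ)..x, (g t).re = (∫ t in (0 : ℝ)..x, g t).re :=
    Complex.reCLM.intervalIntegral_comp_comm hi
  have e2 : ∫ t in (0 : ℝ)..x, (g t).im = (∫ t in (0 : ℝ)..x, g t).im :=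
    Complex.imCLM.intervalIntegral_comp_comm hi
  simp only [e1, e2, Complex.real_smul, mul_one, Complex.re_add_im]

/-- Subtracting the primitive of f' leaves an absolutely continuous function whose derivative
vanishes almost everywhere, hence a constant. -/
theorem integral_eq_sub_of_ae_hasDerivAt {f f' : ℝ → ℂ} {X : ℝ}
    (hf : AbsolutelyContinuousOnInterval f 0 X) (hf' : IntervalIntegrable f' volume 0 X)
    (h : ∀ᵐ x, x ∈ uIcc 0 X → HasDerivAt f (f' x) x) :
    ∫ x in (0 : ℝ)..X, f' x = f X - f 0 := by
  obtain ⟨C, hC⟩ := (hf.fun_sub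
    (absolutelyContinuousOnInterval_primitive hf')).const_of_ae_hasDerivAt_zero (by
      filter_upwards [h, hf'.ae_hasDerivAt_integral] with x hx hx' hxX
      have := (hx hxX).fun_sub (hx' hxX 0 (by simp))
      rwa [sub_self] at this)
  have h0 := hC 0 (by simp)
  have hX := hC X (by simp)
  simp only [intervalIntegral.integral_same, sub_zero] at h0
  rw [h0, ← hX]
  ring

theorem integral_eq_sub_of_ae_hasDerivAt_real {f f' : ℝ → ℝ} {X : ℝ}
    (hf : AbsolutelyContinuousOnInterval f 0 X)
    (h : ∀ᵐ x, x ∈ uIcc 0 X → HasDerivAt f (f' x) x) :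
    ∫ x in (0 : ℝ)..X, f' x = f X - f 0 := by
  rw [← hf.integral_deriv_eq_sub]
  refine intervalIntegral.integral_congr_ae ?_
  filter_upwards [h] with x hx hxX
  exact (hx (uIoc_subset_uIcc hxX)).deriv.symm

/-! ### Weak derivatives on the half-line -/

theorem intervalIntegrable_of_memLp {g : ℝ → ℂ} (hg : MemLp g 2 halfLine) {X : ℝ} (hX : 0 ≤ X) :
    IntervalIntegrable g volume 0 X := by
  rw [intervalIntegrable_iff_integrableOn_Ioc_of_le hX]
  have h : MemLp g 2 (volume.restrict (Ioc 0 X)) :=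
    hg.mono_measure (Measure.restrict_mono Ioc_subset_Ioi_self le_rfl)
  exact h.integrable (by norm_num)

theorem locallyIntegrableOn_of_memLp {g : ℝ → ℂ} (hg : MemLp g 2 halfLine) :
    LocallyIntegrableOn g (Ioi 0) volume := by
  have h : LocallyIntegrable g halfLine := hg.locallyIntegrable (by norm_num)
  exact locallyIntegrableOn_of_locallyIntegrable_restrict h

/-- The difference integrates to zero against every test function. This lets the arbitrary choice in
`weakDeriv` be replaced by any explicit derivative inside integrals. -/
theorem ae_eq_of_isWeakDeriv {f g h : ℝ → ℂ} (hg : HasL2WeakDeriv f g)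
    (hh : HasL2WeakDeriv f h) : g =ᵐ[halfLine] h := by
  have key := isOpen_Ioi.ae_eq_zero_of_integral_contDiff_smul_eq_zero
    (U := Ioi (0 : ℝ)) (f := g - h) (μ := volume)
    (locallyIntegrableOn_of_memLp (hg.1.sub hh.1)) (fun φ h1 h2 h3 => by
      have hi : ∀ k : ℝ → ℂ, MemLp k 2 halfLine →
          Integrable (fun x => (φ x : ℂ) * k x) halfLine := by
        intro k hk
        have : MemLp (fun x => (φ x : ℂ)) 2 halfLine :=
          (((Complex.continuous_ofReal.comp h1.continuous).memLp_of_hasCompactSupport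
            (h2.comp_left (g := fun y : ℝ => (y : ℂ)) (by simp))).restrict _)
        exact this.integrable_mul hk
      have e : ∫ x in Ioi (0 : ℝ), φ x • (g - h) x = 0 := by
        have e1 := hg.2 φ h1 h2 h3
        rw [hh.2 φ h1 h2 h3, neg_inj] at e1
        simp only [Pi.sub_apply, Complex.real_smul, mul_sub]
        rw [integral_sub (hi g hg.1) (hi h hh.1), e1, sub_self]
      rw [← e, ← integral_indicator measurableSet_Ioi]
      congr 1
      ext x
      by_cases hx : x ∈ Ioi (0 : ℝ)
      · simp [hx]
      · have : φ x = 0 := image_eq_zero_of_notMem_tsupport fun hx' => hx (h3 hx')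
        rw [indicator_of_notMem hx, this, zero_smul])
  rw [halfLine, EventuallyEq, ae_restrict_iff' measurableSet_Ioi]
  filter_upwards [key] with x hx hx0
  simpa [sub_eq_zero] using hx hx0

theorem weakDeriv_ae_eq {f g : ℝ → ℂ} (hg : HasL2WeakDeriv f g) :
    weakDeriv f =ᵐ[halfLine] g := by
  have h : ∃ g, HasL2WeakDeriv f g := ⟨g, hg⟩
  rw [weakDeriv, dif_pos h]
  exact ae_eq_of_isWeakDeriv h.choose_spec hg

theorem hasL2WeakDeriv_weakDeriv {f : ℝ → ℂ} (h : MemH1HalfLine f) :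
    HasL2WeakDeriv f (weakDeriv f) := by
  rw [weakDeriv, dif_pos h.2]
  exact h.2.choose_spec

/-- The support of a test function on the open half-line lies in a compact interval. -/
theorem exists_Ioo_support {φ : ℝ → ℝ} (h2 : HasCompactSupport φ)
    (h3 : tsupport φ ⊆ Ioi (0 : ℝ)) :
    ∃ a b : ℝ, 0 < a ∧ a < b ∧ tsupport φ ⊆ Ioo a b := by
  rcases (tsupport φ).eq_empty_or_nonempty with h | h
  · exact ⟨1, 2, by norm_num, by norm_num, by simp [h]⟩
  · obtain ⟨a, ha, ha'⟩ := h2.isCompact.exists_isLeast h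
    obtain ⟨b, hb, hb'⟩ := h2.isCompact.exists_isGreatest h
    have ha0 : 0 < a := h3 ha
    exact ⟨a / 2, b + 1, by linarith, by linarith [ha' hb], fun x hx =>
      ⟨by linarith [ha' hx], by linarith [hb' hx]⟩⟩

/-- Integrating a primitive against a test function. -/
theorem isWeakDeriv_of_eq_primitive {f g : ℝ → ℂ} (hg : MemLp g 2 halfLine)
    (hf : ∀ x, 0 ≤ x → f x = f 0 + ∫ t in (0 : ℝ)..x, g t) : IsWeakDeriv f g := by
  intro φ h1 h2 h3
  obtain ⟨a, b, ha, hab, hs⟩ := exists_Ioo_support h2 h3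
  have hb : 0 ≤ b + 1 := by linarith
  have hz : ∀ x, x ∉ Ioo a b → φ x = 0 := fun x hx =>
    image_eq_zero_of_notMem_tsupport fun hx' => hx (hs hx')
  have hz' : ∀ x, x ∉ Ioo a b → deriv φ x = 0 := fun x hx =>
    image_eq_zero_of_notMem_tsupport fun hx' => hx (hs (tsupport_deriv_subset hx'))
  have hred : ∀ k : ℝ → ℂ, (∀ x, x ∉ Ioo a b → k x = 0) →
      ∫ x in Ioi (0 : ℝ), k x = ∫ x in (0 : ℝ)..(b + 1), k x := by
    intro k hk
    rw [intervalIntegral.integral_of_le hb]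
    refine setIntegral_eq_of_subset_of_forall_sdiff_eq_zero measurableSet_Ioi
      Ioc_subset_Ioi_self fun x hx => hk x fun hx' =>
        hx.2 (mem_Ioc.2 ⟨hx.1, by linarith [hx'.2]⟩)
  rw [hred _ (fun x hx => by simp [hz' x hx]), hred _ (fun x hx => by simp [hz x hx])]
  have hgi := intervalIntegrable_of_memLp hg hb
  set F : ℝ → ℂ := fun x => f 0 + ∫ t in (0 : ℝ)..x, g t with hF
  have hFac : AbsolutelyContinuousOnInterval F 0 (b + 1) :=
    (absolutelyContinuousOnInterval_const (f 0) 0 (b + 1)).fun_add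
      (absolutelyContinuousOnInterval_primitive hgi)
  have hφ1 : ContDiff ℝ 1 φ := h1.of_le (by norm_cast)
  have hφac : AbsolutelyContinuousOnInterval φ 0 (b + 1) :=
    (hφ1.contDiffOn).absolutelyContinuousOnInterval
  have hφ'c : Continuous (deriv φ) := hφ1.continuous_deriv le_rfl
  have i1 : IntervalIntegrable (fun x => ((deriv φ x : ℝ) : ℂ) * F x) volume 0 (b + 1) :=
    ((Complex.continuous_ofReal.comp hφ'c).continuousOn.mul hFac.continuousOn).intervalIntegrable
  have i2 : IntervalIntegrable (fun x => (φ x : ℂ) * g x) volume 0 (b + 1) :=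
    hgi.continuousOn_mul (Complex.continuous_ofReal.comp h1.continuous).continuousOn
  have key := integral_eq_sub_of_ae_hasDerivAt (hφac.fun_smul hFac) (i1.add i2) (by
    filter_upwards [hgi.ae_hasDerivAt_integral] with x hx hxX
    have d1 : HasDerivAt F (g x) x := by
      exact (hx hxX 0 (by simp)).const_add (f 0)
    have d2 : HasDerivAt φ (deriv φ x) x := (hφ1.differentiable (by norm_num) x).hasDerivAt
    have := d2.smul d1
    simp only [Complex.real_smul] at this ⊢
    rw [add_comm] at this
    exact this)
  rw [intervalIntegral.integral_add i1 i2, hz 0 (fun h => by linarith [h.1]),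
    hz (b + 1) (fun h => by linarith [h.2])] at key
  simp only [zero_smul, sub_zero] at key
  rw [← eq_neg_iff_add_eq_zero] at key
  rw [← key]
  refine intervalIntegral.integral_congr fun x hx => ?_
  rw [uIcc_of_le hb] at hx
  simp only [hf x hx.1, hF]

/-- A smooth function with compact support in `(0, ∞)` and zero mean is the derivative of such a
function. -/
theorem exists_testFunction_deriv_eq {h : ℝ → ℝ} (h1 : ContDiff ℝ (⊤ : ℕ∞) h)
    (h2 : HasCompactSupport h) (h3 : tsupport h ⊆ Ioi (0 : ℝ)) (h0 : ∫ x, h x = 0) :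
    ∃ φ : ℝ → ℝ, ContDiff ℝ (⊤ : ℕ∞) φ ∧ HasCompactSupport φ ∧ tsupport φ ⊆ Ioi (0 : ℝ) ∧
      deriv φ = h := by
  obtain ⟨a, b, ha, hab, hs⟩ := exists_Ioo_support h2 h3
  have hz : ∀ x, x ∉ Ioo a b → h x = 0 := fun x hx =>
    image_eq_zero_of_notMem_tsupport fun hx' => hx (hs hx')
  have hd : ∀ x, HasDerivAt (fun x => ∫ t in a..x, h t) (h x) x := fun x =>
    intervalIntegral.integral_hasDerivAt_right (h1.continuous.intervalIntegrable _ _)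
      (h1.continuous.stronglyMeasurableAtFilter _ _) h1.continuous.continuousAt
  have hderiv : deriv (fun x => ∫ t in a..x, h t) = h := funext fun x => (hd x).deriv
  have hsupp : Function.support (fun x => ∫ t in a..x, h t) ⊆ Icc a b := by
    intro x hx
    by_contra hx'
    apply hx
    rcases lt_or_ge x a with hxa | hxa
    · refine (intervalIntegral.integral_congr (g := fun _ => 0) fun t ht => ?_).trans (by simp)
      rw [uIcc_of_ge hxa.le] at ht
      exact hz t fun h' => by linarith [h'.1, ht.2]
    · have hxb : b < x := by
        by_contra h'
        exact hx' ⟨hxa, not_lt.1 h'⟩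
      rw [← h0]
      show ∫ t in a..x, h t = _
      rw [intervalIntegral.integral_of_le hxa]
      refine setIntegral_eq_integral_of_forall_compl_eq_zero fun t ht => hz t fun h' => ht ?_
      exact mem_Ioc.2 ⟨h'.1, by linarith [h'.2]⟩
  have hts : tsupport (fun x => ∫ t in a..x, h t) ⊆ Icc a b :=
    closure_minimal hsupp isClosed_Icc
  refine ⟨fun x => ∫ t in a..x, h t, ?_, ?_, fun x hx => ha.trans_le (hts hx).1, hderiv⟩
  -- Since ∞ = ∞ + 1, smoothness of the primitive reduces to smoothness of its derivative h.
  · rw [show ((⊤ : ℕ∞) : WithTop ℕ∞) = (⊤ : ℕ∞) + 1 by rfl, contDiff_succ_iff_deriv]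
    refine ⟨fun x => (hd x).differentiableAt, by simp, by rwa [hderiv]⟩
  · exact HasCompactSupport.of_support_subset_isCompact isCompact_Icc hsupp

/-- **Du Bois-Reymond**: a continuous function whose integral against derivatives of test
functions vanishes is constant. -/
theorem eq_const_of_integral_deriv_mul_eq_zero {F : ℝ → ℂ} (hF : ContinuousOn F (Ici 0))
    (h : ∀ φ : ℝ → ℝ, ContDiff ℝ (⊤ : ℕ∞) φ → HasCompactSupport φ → tsupport φ ⊆ Ioi (0 : ℝ) →
      ∫ x in Ioi (0 : ℝ), ((deriv φ x : ℝ) : ℂ) * F x = 0) :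
    ∀ x, 0 ≤ x → F x = F 0 := by
  -- A reference bump of unit mass supported in [1, 3]; the constant value of F will be its integral
  -- against this bump.
  let B : ContDiffBump (2 : ℝ) := ⟨1 / 2, 1, by norm_num, by norm_num⟩
  set ψ : ℝ → ℝ := B.normed volume
  have ψ1 : ContDiff ℝ (⊤ : ℕ∞) ψ := B.contDiff_normed
  have ψ2 : HasCompactSupport ψ := B.hasCompactSupport_normed
  have ψ3 : tsupport ψ ⊆ Ioi (0 : ℝ) := by
    rw [B.tsupport_normed_eq]
    intro x hx
    rw [Metric.mem_closedBall, Real.dist_eq] at hx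
    have : |x - 2| ≤ 1 := hx
    have := (abs_le.1 this).1
    show 0 < x
    linarith
  have ψ0 : ∫ x, ψ x = 1 := B.integral_normed
  set C : ℂ := ∫ x in Ioi (0 : ℝ), (ψ x : ℂ) * F x with hC
  have hFi : ∀ η : ℝ → ℝ, Continuous η → HasCompactSupport η → tsupport η ⊆ Ioi (0 : ℝ) →
      IntegrableOn (fun x => (η x : ℂ) * F x) (Ioi 0) := by
    intro η h1 h2 h3
    obtain ⟨a, b, ha, hab, hs⟩ := exists_Ioo_support h2 h3
    have : IntegrableOn (fun x => (η x : ℂ) * F x) (Icc a b) :=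
      ((Complex.continuous_ofReal.comp h1).continuousOn.mul
        (hF.mono fun x hx => ha.le.trans hx.1)).integrableOn_compact isCompact_Icc
    refine (this.of_forall_sdiff_eq_zero measurableSet_Ioi fun x hx => ?_)
    have : η x = 0 := image_eq_zero_of_notMem_tsupport fun hx' => hx.2 (Ioo_subset_Icc_self (hs hx'))
    simp [this]
  have key := isOpen_Ioi.ae_eq_zero_of_integral_contDiff_smul_eq_zero
    (U := Ioi (0 : ℝ)) (f := fun x => F x - C) (μ := volume)
    (((hF.mono Ioi_subset_Ici_self).sub continuousOn_const).locallyIntegrableOn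
      measurableSet_Ioi) (fun η h1 h2 h3 => by
      have e0 : ∫ x, η x • (F x - C) = ∫ x in Ioi (0 : ℝ), (η x : ℂ) * (F x - C) := by
        rw [← integral_indicator measurableSet_Ioi]
        congr 1
        ext x
        by_cases hx : x ∈ Ioi (0 : ℝ)
        · simp [hx]
        · have : η x = 0 := image_eq_zero_of_notMem_tsupport fun hx' => hx (h3 hx')
          rw [indicator_of_notMem hx, this, zero_smul]
      set c : ℝ := ∫ x, η x with hc
      have hηi : Integrable η := h1.continuous.integrable_of_hasCompactSupport h2
      have hψi : Integrable ψ := ψ1.continuous.integrable_of_hasCompactSupport ψ2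
      -- Removing c times the bump from η gives mean zero, so the result is an admissible
      -- derivative.
      obtain ⟨φ, f1, f2, f3, f4⟩ := exists_testFunction_deriv_eq
        (h := fun x => η x - c * ψ x) (h1.sub (contDiff_const.mul ψ1))
        (h2.sub ψ2.mul_left) ((tsupport_sub _ _).trans (union_subset h3
          ((closure_mono (Function.support_mul_subset_right _ _)).trans ψ3)))
        (by rw [integral_sub hηi (hψi.const_mul _), integral_const_mul, ψ0, mul_one, sub_self])
      have e1 := h φ f1 f2 f3
      rw [f4] at e1
      have e2 : ∫ x in Ioi (0 : ℝ), (((η x - c * ψ x : ℝ)) : ℂ) * F x =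
          (∫ x in Ioi (0 : ℝ), (η x : ℂ) * F x) - c * C := by
        rw [hC, ← integral_const_mul, ← integral_sub (hFi η h1.continuous h2 h3)
          ((hFi ψ ψ1.continuous ψ2 ψ3).const_mul _)]
        congr 1
        ext x
        push_cast
        ring
      have e3 : ∫ x in Ioi (0 : ℝ), (η x : ℂ) * C = c * C := by
        rw [integral_mul_const, integral_complex_ofReal, hc]
        congr 2
        refine setIntegral_eq_integral_of_forall_compl_eq_zero fun x hx => ?_
        exact image_eq_zero_of_notMem_tsupport fun hx' => hx (h3 hx')
      rw [e0]
      simp only [mul_sub]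
      have := integral_sub (hFi η h1.continuous h2 h3)
        ((hηi.ofReal.mul_const C).integrableOn (s := Ioi 0))
      simp only [RCLike.ofReal_alg, Complex.real_smul, mul_one] at this
      rw [this, e3, ← e2]
      exact e1)
  have hEq : EqOn F (fun _ => C) (Ioi 0) := by
    refine Measure.eqOn_open_of_ae_eq (μ := volume) ?_ isOpen_Ioi (hF.mono Ioi_subset_Ici_self)
      continuousOn_const
    rw [EventuallyEq, ae_restrict_iff' measurableSet_Ioi]
    filter_upwards [key] with x hx hx0
    exact sub_eq_zero.1 (hx hx0)
  have hEq' : EqOn F (fun _ => C) (Ici 0) :=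
    hEq.of_subset_closure hF continuousOn_const Ioi_subset_Ici_self (by simp)
  intro x hx
  rw [hEq' hx, hEq' (self_mem_Ici (a := (0 : ℝ)))]

/-- The primitive of g has the same weak derivative as f, so by du Bois-Reymond the two differ by a
constant. -/
theorem eq_primitive_of_isWeakDeriv {f g : ℝ → ℂ} (hf : Continuous f)
    (hg : HasL2WeakDeriv f g) :
    ∀ x, 0 ≤ x → f x = f 0 + ∫ t in (0 : ℝ)..x, g t := by
  set G : ℝ → ℂ := fun x => ∫ t in (0 : ℝ)..x, g t with hG
  have hGw : IsWeakDeriv G g := isWeakDeriv_of_eq_primitive hg.1 (by intro x _; simp [hG])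
  have hGc : ContinuousOn G (Ici 0) := by
    intro x hx
    have h := (absolutelyContinuousOnInterval_primitive
      (intervalIntegrable_of_memLp hg.1 (show (0 : ℝ) ≤ x + 1 by
        linarith [show (0 : ℝ) ≤ x from hx]))).continuousOn x
    rw [uIcc_of_le (by linarith [show (0 : ℝ) ≤ x from hx])] at h
    refine (h ⟨hx, by linarith⟩).mono_of_mem_nhdsWithin ?_
    exact mem_nhdsWithin.2 ⟨Iio (x + 1), isOpen_Iio, by simp, fun y hy => ⟨hy.2, hy.1.le⟩⟩
  have hc := eq_const_of_integral_deriv_mul_eq_zero (F := fun x => f x - G x)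
    (hf.continuousOn.sub hGc) (fun φ h1 h2 h3 => by
      have hi : ∀ k : ℝ → ℂ, ContinuousOn k (Ici 0) →
          IntegrableOn (fun x => ((deriv φ x : ℝ) : ℂ) * k x) (Ioi 0) := by
        intro k hk
        obtain ⟨a, b, ha, hab, hs⟩ := exists_Ioo_support h2 h3
        have : IntegrableOn (fun x => ((deriv φ x : ℝ) : ℂ) * k x) (Icc a b) :=
          ((Complex.continuous_ofReal.comp (h1.continuous_deriv (by norm_cast))).continuousOn.mul
            (hk.mono fun x hx => ha.le.trans hx.1)).integrableOn_compact isCompact_Icc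
        refine (this.of_forall_sdiff_eq_zero measurableSet_Ioi fun x hx => ?_)
        have : deriv φ x = 0 :=
          image_eq_zero_of_notMem_tsupport fun hx' => hx.2 (Ioo_subset_Icc_self (hs (tsupport_deriv_subset hx')))
        simp [this]
      simp only [mul_sub]
      rw [integral_sub (hi f hf.continuousOn) (hi G hGc), hg.2 φ h1 h2 h3, hGw φ h1 h2 h3,
        sub_self])
  intro x hx
  have := hc x hx
  simp only [hG, intervalIntegral.integral_same, sub_zero] at this
  rw [← this]
  ring

/-! ### The energy identity on an edge -/

/-- `f` is continuous and lies in `H¹(0, ∞)` with derivative `g`. -/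
structure IsH1Pair (f g : ℝ → ℂ) : Prop where
  continuous : Continuous f
  memLp : MemLp f 2 halfLine
  memLp_deriv : MemLp g 2 halfLine
  eq_primitive : ∀ x, 0 ≤ x → f x = f 0 + ∫ t in (0 : ℝ)..x, g t

/-- The mass of `f` on the half-line. -/
noncomputable def edgeMass (f : ℝ → ℂ) : ℝ := ∫ x in Ioi (0 : ℝ), ‖f x‖ ^ 2

/-- `l - M / 2`, where `M x` is the mass of `f` on `(x, ∞)`. -/
noncomputable def slope (l : ℝ) (f : ℝ → ℂ) (x : ℝ) : ℝ :=
  l - edgeMass f / 2 + (∫ t in (0 : ℝ)..x, ‖f t‖ ^ 2) / 2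

theorem slope_zero (l : ℝ) (f : ℝ → ℂ) : slope l f 0 = l - edgeMass f / 2 := by
  simp [slope]

theorem hasDerivAt_slope (l : ℝ) {f : ℝ → ℂ} (hf : Continuous f) (x : ℝ) :
    HasDerivAt (slope l f) (‖f x‖ ^ 2 / 2) x := by
  have hc : Continuous fun t => ‖f t‖ ^ 2 := by fun_prop
  have := intervalIntegral.integral_hasDerivAt_right (hc.intervalIntegrable 0 x)
      (hc.stronglyMeasurableAtFilter _ _) hc.continuousAt
  exact (this.div_const 2).const_add _

theorem continuous_slope (l : ℝ) {f : ℝ → ℂ} (hf : Continuous f) : Continuous (slope l f) :=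
  continuous_iff_continuousAt.2 fun x => (hasDerivAt_slope l hf x).continuousAt

theorem integrable_normSq {f : ℝ → ℂ} (hf : MemLp f 2 halfLine) :
    Integrable (fun x => ‖f x‖ ^ 2) halfLine := by
  have := hf.integrable_norm_rpow (by norm_num) (by norm_num)
  simpa using this

theorem tendsto_slope (l : ℝ) {f : ℝ → ℂ} (hf : MemLp f 2 halfLine) :
    Tendsto (slope l f) atTop (𝓝 l) := by
  have h := intervalIntegral_tendsto_integral_Ioi 0 (integrable_normSq hf) tendsto_id
  have := (h.div_const 2).const_add (l - edgeMass f / 2)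
  rw [show l - edgeMass f / 2 + (∫ x in Ioi (0 : ℝ), ‖f x‖ ^ 2) / 2 = l by
    rw [edgeMass]; ring] at this
  exact this

namespace IsH1Pair

variable {f g : ℝ → ℂ}

theorem integrable_re_mul (h : IsH1Pair f g) :
    Integrable (fun x => (f x).re * (g x).re + (f x).im * (g x).im) halfLine := by
  have h1 : Integrable (fun x => (f x).re * (g x).re) halfLine :=
    h.memLp.re.integrable_mul h.memLp_deriv.re
  have h2 : Integrable (fun x => (f x).im * (g x).im) halfLine :=
    h.memLp.im.integrable_mul h.memLp_deriv.im
  exact h1.add h2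

theorem absolutelyContinuous (h : IsH1Pair f g) {X : ℝ} (hX : 0 ≤ X) :
    AbsolutelyContinuousOnInterval f 0 X := by
  refine ((absolutelyContinuousOnInterval_const (f 0) 0 X).fun_add
    (absolutelyContinuousOnInterval_primitive
      (intervalIntegrable_of_memLp h.memLp_deriv hX))).congr_of_eqOn fun x hx => ?_
  rw [uIcc_of_le hX] at hx
  exact (h.eq_primitive x hx.1).symm

theorem ae_hasDerivAt (h : IsH1Pair f g) {X : ℝ} (hX : 0 ≤ X) :
    ∀ᵐ x, x ∈ uIcc 0 X → HasDerivAt f (g x) x := by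
  -- The primitive formula is known only on x ≥ 0, so a two-sided derivative at 0 is out of reach;
  -- one point is negligible.
  have h0 : ∀ᵐ x : ℝ, x ≠ 0 := by simp [ae_iff, measure_singleton]
  filter_upwards [(intervalIntegrable_of_memLp h.memLp_deriv hX).ae_hasDerivAt_integral, h0]
    with x hx hx0 hxX
  have h1 := (hx hxX 0 (by simp)).const_add (f 0)
  rw [uIcc_of_le hX] at hxX
  refine h1.congr_of_eventuallyEq ?_
  filter_upwards [lt_mem_nhds (lt_of_le_of_ne hxX.1 hx0.symm)] with y hy
  exact h.eq_primitive y hy.le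

theorem absolutelyContinuous_normSq (h : IsH1Pair f g) {X : ℝ} (hX : 0 ≤ X) :
    AbsolutelyContinuousOnInterval (fun x => ‖f x‖ ^ 2) 0 X := by
  have hac := h.absolutelyContinuous hX
  have hre : AbsolutelyContinuousOnInterval (fun x => (f x).re) 0 X := by
    rw [absolutelyContinuousOnInterval_iff] at hac ⊢
    intro ε hε
    obtain ⟨δ, hδ, H⟩ := hac ε hε
    refine ⟨δ, hδ, fun E hE hE' => (Finset.sum_le_sum fun i _ => ?_).trans_lt (H E hE hE')⟩
    rw [Real.dist_eq, Complex.dist_eq, ← Complex.sub_re]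
    exact Complex.abs_re_le_norm _
  have him : AbsolutelyContinuousOnInterval (fun x => (f x).im) 0 X := by
    rw [absolutelyContinuousOnInterval_iff] at hac ⊢
    intro ε hε
    obtain ⟨δ, hδ, H⟩ := hac ε hε
    refine ⟨δ, hδ, fun E hE hE' => (Finset.sum_le_sum fun i _ => ?_).trans_lt (H E hE hE')⟩
    rw [Real.dist_eq, Complex.dist_eq, ← Complex.sub_im]
    exact Complex.abs_im_le_norm _
  refine ((hre.fun_mul hre).fun_add (him.fun_mul him)).congr_of_eqOn fun x _ => ?_
  simp only
  rw [← Complex.normSq_eq_norm_sq, Complex.normSq_apply]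

theorem hasDerivAt_normSq {x : ℝ} (h : HasDerivAt f (g x) x) :
    HasDerivAt (fun x => ‖f x‖ ^ 2) (2 * ((f x).re * (g x).re + (f x).im * (g x).im)) x := by
  have h1 : HasDerivAt (fun x => (f x).re) (g x).re x :=
    (Complex.reCLM.hasFDerivAt.comp_hasDerivAt x h)
  have h2 : HasDerivAt (fun x => (f x).im) (g x).im x :=
    (Complex.imCLM.hasFDerivAt.comp_hasDerivAt x h)
  have h3 := (h1.fun_mul h1).fun_add (h2.fun_mul h2)
  have e : (fun x => ‖f x‖ ^ 2) = fun x => (f x).re * (f x).re + (f x).im * (f x).im := by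
    ext y
    rw [← Complex.normSq_eq_norm_sq, Complex.normSq_apply]
  rw [e]
  convert! h3 using 1
  ring

/-- The derivative of |f|² is integrable, so |f|² has a limit at infinity; integrability of |f|²
itself forces that limit to be 0. -/
theorem tendsto_normSq (h : IsH1Pair f g) :
    Tendsto (fun x => ‖f x‖ ^ 2) atTop (𝓝 0) := by
  have h1 := (intervalIntegral_tendsto_integral_Ioi 0
    (h.integrable_re_mul.const_mul 2) tendsto_id).const_add (‖f 0‖ ^ 2)
  have h2 : Tendsto (fun x => ‖f x‖ ^ 2) atTop
      (𝓝 (‖f 0‖ ^ 2 + ∫ x in Ioi (0 : ℝ), 2 * ((f x).re * (g x).re + (f x).im * (g x).im))) := by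
    refine h1.congr' ?_
    filter_upwards [eventually_ge_atTop 0] with X hX
    have := integral_eq_sub_of_ae_hasDerivAt_real (h.absolutelyContinuous_normSq hX)
      (by filter_upwards [h.ae_hasDerivAt hX] with x hx hxX using hasDerivAt_normSq (hx hxX))
    simp only [id] at this ⊢
    linarith
  have h3 : IntegrableAtFilter (fun x => ‖f x‖ ^ 2) atTop volume :=
    ⟨Ioi 0, Ioi_mem_atTop 0, integrable_normSq h.memLp⟩
  have h4 := h3.eq_zero_of_tendsto (fun s hs => by
    obtain ⟨a, ha⟩ := mem_atTop_sets.1 hs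
    refine top_le_iff.1 ((Real.volume_Ici (a := a)).symm.trans_le
      (measure_mono fun x hx => ha x hx))) h2
  rwa [h4] at h2

theorem exists_bound (h : IsH1Pair f g) : ∃ C, ∀ x, 0 ≤ x → ‖f x‖ ≤ C := by
  obtain ⟨a, ha⟩ := eventually_atTop.1
    (h.tendsto_normSq.eventually (gt_mem_nhds (zero_lt_one' ℝ)))
  obtain ⟨C, hC⟩ := (isCompact_Icc (a := (0 : ℝ)) (b := a)).exists_bound_of_continuousOn
    h.continuous.continuousOn
  refine ⟨max C 1, fun x hx => ?_⟩
  rcases le_total x a with hxa | hxa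
  · exact (hC x ⟨hx, hxa⟩).trans (le_max_left _ _)
  · have := ha x hxa
    exact le_max_of_le_right (by nlinarith [norm_nonneg (f x)])

theorem integrable_mul_normSq (h : IsH1Pair f g) {k : ℝ → ℝ} (hk : Continuous k) {C : ℝ}
    (hC : ∀ x, 0 ≤ x → |k x| ≤ C) : Integrable (fun x => k x * ‖f x‖ ^ 2) halfLine := by
  refine (integrable_normSq h.memLp).bdd_mul (c := C) hk.aestronglyMeasurable ?_
  filter_upwards [ae_restrict_mem measurableSet_Ioi] with x hx
  exact hC x (le_of_lt hx)

theorem integrable_norm_pow_four (h : IsH1Pair f g) :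
    Integrable (fun x => ‖f x‖ ^ 4) halfLine := by
  obtain ⟨C, hC⟩ := h.exists_bound
  have hf := h.continuous
  have := h.integrable_mul_normSq (k := fun x => ‖f x‖ ^ 2) (by fun_prop) (C := C ^ 2)
    (fun x hx => by
      rw [abs_of_nonneg (by positivity)]
      exact pow_le_pow_left₀ (norm_nonneg _) (hC x hx) 2)
  refine this.congr (ae_of_all _ fun x => ?_)
  simp only
  ring

theorem abs_slope_le (h : IsH1Pair f g) (l : ℝ) :
    ∀ x, 0 ≤ x → |slope l f x| ≤ |l| + edgeMass f := by
  intro x hx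
  have h0 : 0 ≤ ∫ t in (0 : ℝ)..x, ‖f t‖ ^ 2 :=
    intervalIntegral.integral_nonneg hx fun t _ => by positivity
  have h1 : ∫ t in (0 : ℝ)..x, ‖f t‖ ^ 2 ≤ edgeMass f := by
    rw [intervalIntegral.integral_of_le hx]
    exact setIntegral_mono_set (integrable_normSq h.memLp) (ae_of_all _ fun t => by positivity)
      Ioc_subset_Ioi_self.eventuallyLE
  rw [slope, abs_le]
  constructor <;> linarith [neg_abs_le l, le_abs_self l]

theorem memLp_deriv_add (h : IsH1Pair f g) (l : ℝ) :
    MemLp (fun x => g x + (slope l f x : ℂ) * f x) 2 halfLine := by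
  refine h.memLp_deriv.add ?_
  refine h.memLp.of_le_mul (c := |l| + edgeMass f)
    (((Complex.continuous_ofReal.comp (continuous_slope l h.continuous)).mul
      h.continuous).aestronglyMeasurable) ?_
  filter_upwards [ae_restrict_mem measurableSet_Ioi] with x hx
  rw [norm_mul, Complex.norm_real, Real.norm_eq_abs]
  exact mul_le_mul_of_nonneg_right (h.abs_slope_le l x (le_of_lt hx)) (norm_nonneg _)

/-- Completing the square in the energy of an edge. -/
theorem energy_identity (h : IsH1Pair f g) (l : ℝ) :
    (∫ x in Ioi (0 : ℝ), ‖g x‖ ^ 2) - (1 / 2) * ∫ x in Ioi (0 : ℝ), ‖f x‖ ^ 4 =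
      (∫ x in Ioi (0 : ℝ), ‖g x + (slope l f x : ℂ) * f x‖ ^ 2)
        + (l - edgeMass f / 2) * ‖f 0‖ ^ 2
        + 2 / 3 * ((l - edgeMass f / 2) ^ 3 - l ^ 3) := by
  have i1 := integrable_normSq (h.memLp_deriv_add l)
  have i2 := integrable_normSq h.memLp_deriv
  have i3 := h.integrable_norm_pow_four.const_mul (1 / 2)
  set w := slope l f with hw
  -- The integrand is the derivative of w|f|² + ⅔w³, because w' = |f|²/2. As X → ∞ the boundary term
  -- at X tends to ⅔l³.
  have key : ∀ X : ℝ, 0 ≤ X →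
      ∫ x in (0 : ℝ)..X, (‖g x + (w x : ℂ) * f x‖ ^ 2 - ‖g x‖ ^ 2 + 1 / 2 * ‖f x‖ ^ 4) =
        (w X * ‖f X‖ ^ 2 + 2 / 3 * w X ^ 3) - (w 0 * ‖f 0‖ ^ 2 + 2 / 3 * w 0 ^ 3) := by
    intro X hX
    have w1 : ContDiff ℝ 1 w := contDiff_one_iff_deriv.2
      ⟨fun x => (hasDerivAt_slope l h.continuous x).differentiableAt, by
        have hf := h.continuous
        rw [show deriv w = fun x => ‖f x‖ ^ 2 / 2 from
          funext fun x => (hasDerivAt_slope l h.continuous x).deriv]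
        fun_prop⟩
    have ac1 : AbsolutelyContinuousOnInterval w 0 X :=
      w1.contDiffOn.absolutelyContinuousOnInterval
    have ac2 : AbsolutelyContinuousOnInterval (fun x => 2 / 3 * w x ^ 3) 0 X :=
      (contDiff_const.mul (w1.pow 3)).contDiffOn.absolutelyContinuousOnInterval
    refine integral_eq_sub_of_ae_hasDerivAt_real
      (f := fun x => w x * ‖f x‖ ^ 2 + 2 / 3 * w x ^ 3)
      ((ac1.fun_mul (h.absolutelyContinuous_normSq hX)).fun_add ac2) ?_
    filter_upwards [h.ae_hasDerivAt hX] with x hx hxX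
    have d1 := hasDerivAt_slope l h.continuous x
    have d2 := hasDerivAt_normSq (hx hxX)
    have d3 := (d1.fun_mul d2).fun_add ((d1.fun_pow 3).const_mul (2 / 3))
    convert! d3 using 1
    have e4 : ‖f x‖ ^ 4 = (‖f x‖ ^ 2) ^ 2 := by ring
    rw [e4]
    simp only [← Complex.normSq_eq_norm_sq, Complex.normSq_apply, Complex.add_re, Complex.add_im,
      Complex.mul_re, Complex.mul_im, Complex.ofReal_re, Complex.ofReal_im]
    push_cast
    ring
  have t1 := intervalIntegral_tendsto_integral_Ioi 0 ((i1.sub i2).add i3) tendsto_id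
  have t2 : Tendsto (fun X => (w X * ‖f X‖ ^ 2 + 2 / 3 * w X ^ 3)
      - (w 0 * ‖f 0‖ ^ 2 + 2 / 3 * w 0 ^ 3)) atTop
      (𝓝 ((l * 0 + 2 / 3 * l ^ 3) - (w 0 * ‖f 0‖ ^ 2 + 2 / 3 * w 0 ^ 3))) :=
    ((((tendsto_slope l h.memLp).mul h.tendsto_normSq).add
      (((tendsto_slope l h.memLp).pow 3).const_mul (2 / 3))).sub_const _)
  have t3 := tendsto_nhds_unique (t2.congr' (by
    filter_upwards [eventually_ge_atTop 0] with X hX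
    rw [← key X hX]
    rfl)) t1
  have t4 : ∫ x in Ioi (0 : ℝ), (‖g x + (w x : ℂ) * f x‖ ^ 2 - ‖g x‖ ^ 2 + 1 / 2 * ‖f x‖ ^ 4) =
      (∫ x in Ioi (0 : ℝ), ‖g x + (w x : ℂ) * f x‖ ^ 2) - (∫ x in Ioi (0 : ℝ), ‖g x‖ ^ 2)
        + 1 / 2 * ∫ x in Ioi (0 : ℝ), ‖f x‖ ^ 4 := by
    have e1 := integral_add (i1.sub i2) i3
    simp only [Pi.sub_apply] at e1
    rw [e1, integral_sub i1 i2, integral_const_mul]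
  have t5 := t3.trans t4
  rw [hw, slope_zero] at t5
  rw [hw]
  linarith

end IsH1Pair

/-! ### Functions with vanishing square on an edge -/

theorem eq_initial_of_hasDerivAt_zero {F : Type*} [NormedAddCommGroup F] [NormedSpace ℝ F]
    {p : ℝ → F} (h : ∀ x, 0 ≤ x → HasDerivAt p 0 x) {x : ℝ} (hx : 0 ≤ x) : p x = p 0 :=
  constant_of_has_deriv_right_zero (a := 0) (b := x)
    (fun y hy => (h y hy.1).continuousAt.continuousWithinAt)
    (fun y hy => (h y hy.1).hasDerivWithinAt) x ⟨hx, le_rfl⟩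

theorem eq_zero_of_linear_ode {p k : ℝ → ℝ} (hk : Continuous k)
    (h : ∀ x, 0 ≤ x → HasDerivAt p (k x * p x) x) (h0 : p 0 = 0) {x : ℝ} (hx : 0 ≤ x) :
    p x = 0 := by
  set K : ℝ → ℝ := fun x => ∫ t in (0 : ℝ)..x, k t with hK
  have hd : ∀ x, HasDerivAt K (k x) x := fun x =>
    intervalIntegral.integral_hasDerivAt_right (hk.intervalIntegrable 0 x)
      (hk.stronglyMeasurableAtFilter _ _) hk.continuousAt
  have key := eq_initial_of_hasDerivAt_zero (p := fun x => p x * Real.exp (-K x))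
    (fun x hx => by
      convert! (h x hx).fun_mul (hd x).fun_neg.exp using 1
      ring) hx
  simp only [h0, zero_mul] at key
  exact (mul_eq_zero.1 key).resolve_right (Real.exp_ne_zero _)

namespace IsH1Pair

variable {f g : ℝ → ℂ}

/-- When the square in the energy identity vanishes, `f` is continuously differentiable and solves
`f' = -w f`; this provides a function that agrees with `f` on the half-line. -/
theorem exists_classical_solution (h : IsH1Pair f g) (l : ℝ)
    (h0 : ∫ x in Ioi (0 : ℝ), ‖g x + (slope l f x : ℂ) * f x‖ ^ 2 = 0) :
    ∃ U : ℝ → ℂ, (∀ x, 0 ≤ x → U x = f x) ∧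
      ∀ x, 0 ≤ x → HasDerivAt U (-(slope l f x : ℂ) * U x) x := by
  have hg : g =ᵐ[halfLine] fun x => -(slope l f x : ℂ) * f x := by
    have := (integral_eq_zero_iff_of_nonneg (fun x => by positivity)
      (integrable_normSq (h.memLp_deriv_add l))).1 h0
    filter_upwards [this] with x hx
    have hx' : ‖g x + (slope l f x : ℂ) * f x‖ = 0 := by simpa using hx
    rw [norm_eq_zero] at hx'
    linear_combination hx'
  have hc : Continuous fun x => -(slope l f x : ℂ) * f x :=
    (Complex.continuous_ofReal.comp (continuous_slope l h.continuous)).neg.mul h.continuous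
  have hU : ∀ x, 0 ≤ x → f 0 + ∫ t in (0 : ℝ)..x, -(slope l f t : ℂ) * f t = f x := by
    intro x hx
    rw [h.eq_primitive x hx]
    congr 1
    rw [intervalIntegral.integral_of_le hx, intervalIntegral.integral_of_le hx]
    exact integral_congr_ae (ae_restrict_of_ae_restrict_of_subset Ioc_subset_Ioi_self hg.symm)
  -- The witness is f 0 plus the primitive of -wf, which is differentiable from both sides even at
  -- 0.
  refine ⟨_, hU, fun x hx => ?_⟩
  rw [hU x hx]
  exact (intervalIntegral.integral_hasDerivAt_right (hc.intervalIntegrable 0 x)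
      (hc.stronglyMeasurableAtFilter _ _) hc.continuousAt).const_add (f 0)

/-- The profile of an edge on which the square in the energy identity vanishes. -/
theorem eq_profile_of_integral_eq_zero (h : IsH1Pair f g) {l t : ℝ}
    (ht : l * Real.tanh t = l - edgeMass f / 2)
    (h0 : ∫ x in Ioi (0 : ℝ), ‖g x + (slope l f x : ℂ) * f x‖ ^ 2 = 0) :
    ‖f 0‖ ^ 2 = 2 * (l ^ 2 - (l * Real.tanh t) ^ 2) ∧
      ∀ x, 0 ≤ x → f x * Real.cosh (l * x + t) = f 0 * Real.cosh t := by
  obtain ⟨U, hU, hU'⟩ := h.exists_classical_solution l h0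
  set w := slope l f with hw
  have hw0 : w 0 = l * Real.tanh t := by rw [hw, slope_zero, ht]
  have dw : ∀ x, 0 ≤ x → HasDerivAt w (‖U x‖ ^ 2 / 2) x := fun x hx => by
    rw [hU x hx]
    exact hasDerivAt_slope l h.continuous x
  -- A first integral of the system w' = |U|²/2, U' = -wU; its value l² is read off at infinity.
  have hfirst : ∀ x, 0 ≤ x → w x ^ 2 + ‖U x‖ ^ 2 / 2 = w 0 ^ 2 + ‖U 0‖ ^ 2 / 2 := fun x hx =>
    eq_initial_of_hasDerivAt_zero (p := fun x => w x ^ 2 + ‖U x‖ ^ 2 / 2) (fun x hx => by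
      have d := hasDerivAt_normSq (g := fun x => -(w x : ℂ) * U x) (hU' x hx)
      convert! ((dw x hx).fun_pow 2).fun_add (d.div_const 2) using 1
      simp only [← Complex.normSq_eq_norm_sq, Complex.normSq_apply, Complex.mul_re,
        Complex.mul_im, Complex.neg_re, Complex.neg_im, Complex.ofReal_re, Complex.ofReal_im]
      push_cast
      ring) hx
  have hlim : w 0 ^ 2 + ‖U 0‖ ^ 2 / 2 = l ^ 2 := by
    have t1 : Tendsto (fun x => w x ^ 2 + ‖f x‖ ^ 2 / 2) atTop (𝓝 (l ^ 2 + 0 / 2)) :=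
      ((tendsto_slope l h.memLp).pow 2).add (h.tendsto_normSq.div_const 2)
    have t2 : Tendsto (fun x => w x ^ 2 + ‖f x‖ ^ 2 / 2) atTop
        (𝓝 (w 0 ^ 2 + ‖U 0‖ ^ 2 / 2)) := by
      refine tendsto_const_nhds.congr' ?_
      filter_upwards [eventually_ge_atTop 0] with x hx
      rw [← hU x hx, hfirst x hx]
    have := tendsto_nhds_unique t2 t1
    linarith
  have hy : ∀ x, HasDerivAt (fun x => Real.cosh (l * x + t)) (l * Real.sinh (l * x + t)) x :=
    fun x => by
      have := (((hasDerivAt_id x).const_mul l).add_const t).cosh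
      convert! this using 1
      simp; ring
  have hs : ∀ x, HasDerivAt (fun x => Real.sinh (l * x + t)) (l * Real.cosh (l * x + t)) x :=
    fun x => by
      have := (((hasDerivAt_id x).const_mul l).add_const t).sinh
      convert! this using 1
      simp; ring
  -- This encodes w = l tanh(lx + t). With w' = l² - w², the left side p satisfies p' = -wp and p(0)
  -- = 0.
  have hq : ∀ x, 0 ≤ x → w x * Real.cosh (l * x + t) - l * Real.sinh (l * x + t) = 0 := by
    intro x hx
    refine eq_zero_of_linear_ode
      (p := fun x => w x * Real.cosh (l * x + t) - l * Real.sinh (l * x + t))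
      (k := fun x => -w x) (continuous_slope l h.continuous).neg (fun x hx => ?_) ?_ hx
    · convert! ((dw x hx).fun_mul (hy x)).fun_sub ((hs x).const_mul l) using 1
      have := hfirst x hx
      rw [hlim] at this
      linear_combination (-Real.cosh (l * x + t)) * this
    · simp only [mul_zero, zero_add]
      rw [hw0, Real.tanh_eq_sinh_div_cosh]
      have := (Real.cosh_pos t).ne'
      field_simp
      ring
  refine ⟨?_, fun x hx => ?_⟩
  · rw [← hw0, ← hU 0 le_rfl]
    linarith
  -- The derivative of this product is -U(w cosh - l sinh), which has just been shown to vanish.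
  · have := eq_initial_of_hasDerivAt_zero (p := fun x => U x * (Real.cosh (l * x + t) : ℂ))
      (fun x hx => by
        convert! (hU' x hx).fun_mul (hy x).ofReal_comp using 1
        have := hq x hx
        have e : (w x : ℂ) * (Real.cosh (l * x + t) : ℂ) - l * (Real.sinh (l * x + t) : ℂ) = 0 := by
          exact_mod_cast this
        push_cast at e ⊢
        linear_combination (U x) * e) hx
    simpa only [mul_zero, zero_add, hU x hx, hU 0 le_rfl] using this

end IsH1Pair

/-! ### The hyperbolic profile -/

theorem tendsto_tanh_atTop : Tendsto Real.tanh atTop (𝓝 1) := by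
  have h1 : Tendsto (fun x : ℝ => 1 - Real.exp (-x)) atTop (𝓝 (1 - 0)) :=
    (Real.tendsto_exp_neg_atTop_nhds_zero).const_sub 1
  rw [sub_zero] at h1
  refine tendsto_of_tendsto_of_tendsto_of_le_of_le h1 tendsto_const_nhds (fun x => ?_)
    (fun x => (Real.tanh_lt_one x).le)
  have hc := Real.one_le_cosh x
  rw [Real.tanh_eq_sinh_div_cosh, le_div_iff₀ (by linarith)]
  have := Real.cosh_sub_sinh x
  nlinarith [Real.exp_pos (-x)]

theorem hasDerivAt_tanh_affine (l t x : ℝ) :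
    HasDerivAt (fun x => Real.tanh (l * x + t)) (l * (1 - Real.tanh (l * x + t) ^ 2)) x := by
  have ha : HasDerivAt (fun x => l * x + t) l x := by
    simpa using ((hasDerivAt_id x).const_mul l).add_const t
  have hc := (Real.cosh_pos (l * x + t)).ne'
  have e : (fun x => Real.tanh (l * x + t)) =
      fun x => Real.sinh (l * x + t) / Real.cosh (l * x + t) :=
    funext fun x => Real.tanh_eq_sinh_div_cosh _
  rw [e, Real.tanh_eq_sinh_div_cosh]
  convert! ha.sinh.fun_div ha.cosh hc using 1
  field_simp

theorem sech_sq (x : ℝ) : sech x ^ 2 = 1 - Real.tanh x ^ 2 := by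
  have hc := (Real.cosh_pos x).ne'
  rw [sech, Real.tanh_eq_sinh_div_cosh]
  field_simp
  linarith [Real.cosh_sq x]

section Profile

variable {N : ℕ} {γ ω : ℝ}

theorem hasDerivAt_profile (x : ℝ) :
    HasDerivAt (profile N γ ω)
      (-(√ω * Real.tanh (√ω * x + Real.artanh (γ / (N * √ω)))) * profile N γ ω x) x := by
  set t := Real.artanh (γ / (N * √ω)) with ht
  have ha : HasDerivAt (fun x => √ω * x + t) √ω x := by
    simpa using ((hasDerivAt_id x).const_mul √ω).add_const t
  have hc := (Real.cosh_pos (√ω * x + t)).ne'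
  have := ((hasDerivAt_const x (1 : ℝ)).fun_div ha.cosh hc).const_mul √(2 * ω)
  convert! this using 1
  rw [profile, sech, Real.tanh_eq_sinh_div_cosh, ← ht]
  field_simp
  ring

theorem profile_sq (hω : 0 ≤ ω) (x : ℝ) : profile N γ ω x ^ 2 =
    2 * √ω * (√ω * (1 - Real.tanh (√ω * x + Real.artanh (γ / (N * √ω))) ^ 2)) := by
  rw [profile, mul_pow, sech_sq, Real.sq_sqrt (by positivity)]
  linear_combination (-2 * (1 - Real.tanh (√ω * x + Real.artanh (γ / (N * √ω))) ^ 2)) *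
    Real.sq_sqrt hω

theorem continuous_profile : Continuous (profile N γ ω) :=
  continuous_iff_continuousAt.2 fun x => (hasDerivAt_profile x).continuousAt

/-- The scalar bound state on the graph. -/
noncomputable abbrev boundState (N : ℕ) (γ ω : ℝ) : Fun N := scaledProfile N γ ω 1

theorem onHalfLine_boundState (e : Fin N) {x : ℝ} (hx : 0 ≤ x) :
    onHalfLine (boundState N γ ω e) x = (profile N γ ω x : ℂ) := by
  simp [onHalfLine, scaledProfile, Real.coe_toNNReal x hx]

/-- This explicit antiderivative yields square integrability, the edge mass and the slope function
of the bound state. -/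
theorem hasDerivAt_primitive_profile_sq (hω : 0 ≤ ω) (x : ℝ) :
    HasDerivAt (fun x => 2 * √ω * Real.tanh (√ω * x + Real.artanh (γ / (N * √ω))))
      (profile N γ ω x ^ 2) x := by
  rw [profile_sq hω]
  exact (hasDerivAt_tanh_affine _ _ x).const_mul _

theorem tendsto_primitive_profile_sq (hω : 0 < ω) :
    Tendsto (fun x => 2 * √ω * Real.tanh (√ω * x + Real.artanh (γ / (N * √ω)))) atTop
      (𝓝 (2 * √ω * 1)) :=
  ((tendsto_tanh_atTop.comp (tendsto_atTop_add_const_right _ _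
    (tendsto_id.const_mul_atTop (Real.sqrt_pos.2 hω)))).const_mul _)

theorem memLp_profile (hω : 0 < ω) : MemLp (fun x => (profile N γ ω x : ℂ)) 2 halfLine := by
  have hm : AEStronglyMeasurable (fun x => (profile N γ ω x : ℂ)) halfLine :=
    (Complex.continuous_ofReal.comp continuous_profile).aestronglyMeasurable
  rw [memLp_two_iff_integrable_sq_norm hm]
  have := integrableOn_Ioi_deriv_of_nonneg' (a := 0)
    (fun x _ => hasDerivAt_primitive_profile_sq (N := N) (γ := γ) hω.le x)
    (fun x _ => by positivity) (tendsto_primitive_profile_sq hω)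
  refine this.congr (ae_of_all _ fun x => ?_)
  simp

theorem isH1Pair_boundState (hω : 0 < ω) (e : Fin N) :
    IsH1Pair (onHalfLine (boundState N γ ω e)) (fun x =>
      -((√ω * Real.tanh (√ω * x + Real.artanh (γ / (N * √ω))) : ℝ) : ℂ) * profile N γ ω x) where
  continuous := by
    have := continuous_profile (N := N) (γ := γ) (ω := ω)
    show Continuous fun x : ℝ => (1 : ℂ) * (profile N γ ω (x.toNNReal : ℝ) : ℂ)
    fun_prop
  memLp := by
    refine (memLp_profile (N := N) (γ := γ) hω).ae_eq ?_
    filter_upwards [ae_restrict_mem measurableSet_Ioi] with x hx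
    exact (onHalfLine_boundState e (le_of_lt hx)).symm
  memLp_deriv := by
    have hc : Continuous fun x => √ω * Real.tanh (√ω * x + Real.artanh (γ / (N * √ω))) :=
      (continuous_iff_continuousAt.2 fun x =>
        (hasDerivAt_tanh_affine _ _ x).continuousAt).const_mul _
    refine (memLp_profile (N := N) (γ := γ) hω).of_le_mul (c := √ω)
      ((Complex.continuous_ofReal.comp hc).neg.mul
        (Complex.continuous_ofReal.comp continuous_profile)).aestronglyMeasurable
      (ae_of_all _ fun x => ?_)
    rw [norm_mul, norm_neg, Complex.norm_real, Real.norm_eq_abs, abs_mul,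
      abs_of_nonneg (Real.sqrt_nonneg ω)]
    refine mul_le_mul_of_nonneg_right ?_ (norm_nonneg _)
    exact mul_le_of_le_one_right (Real.sqrt_nonneg ω) (Real.abs_tanh_lt_one _).le
  eq_primitive := fun x hx => by
    have hc : Continuous fun x => √ω * Real.tanh (√ω * x + Real.artanh (γ / (N * √ω))) :=
      (continuous_iff_continuousAt.2 fun x =>
        (hasDerivAt_tanh_affine _ _ x).continuousAt).const_mul _
    have hi := intervalIntegral.integral_eq_sub_of_hasDerivAt (a := 0) (b := x)
      (fun y _ => (hasDerivAt_profile (N := N) (γ := γ) (ω := ω) y).ofReal_comp)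
      ((Complex.continuous_ofReal.comp (hc.neg.mul continuous_profile)).intervalIntegrable _ _)
    rw [onHalfLine_boundState e hx, onHalfLine_boundState e le_rfl, ← sub_eq_iff_eq_add', ← hi]
    push_cast
    rfl

theorem edgeMass_boundState (hω : 0 < ω) (e : Fin N) :
    edgeMass (onHalfLine (boundState N γ ω e)) =
      2 * √ω * (1 - Real.tanh (Real.artanh (γ / (N * √ω)))) := by
  have := integral_Ioi_of_hasDerivAt_of_nonneg' (a := 0)
    (fun x _ => hasDerivAt_primitive_profile_sq (N := N) (γ := γ) hω.le x)
    (fun x _ => by positivity) (tendsto_primitive_profile_sq hω)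
  rw [edgeMass]
  refine (setIntegral_congr_fun measurableSet_Ioi fun x hx => ?_).trans (this.trans ?_)
  · simp only [onHalfLine_boundState e (le_of_lt (mem_Ioi.1 hx)), Complex.norm_real,
      Real.norm_eq_abs, sq_abs]
  · simp only [mul_zero, zero_add]
    ring

/-- This is minus the logarithmic derivative of the profile, so the square in the energy identity
vanishes on the bound state. -/
theorem slope_boundState (hω : 0 < ω) (e : Fin N) {x : ℝ} (hx : 0 ≤ x) :
    slope √ω (onHalfLine (boundState N γ ω e)) x =
      √ω * Real.tanh (√ω * x + Real.artanh (γ / (N * √ω))) := by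
  have hi := intervalIntegral.integral_eq_sub_of_hasDerivAt (a := 0) (b := x)
    (fun y _ => hasDerivAt_primitive_profile_sq (N := N) (γ := γ) hω.le y)
    ((continuous_profile.pow 2).intervalIntegrable _ _)
  have hi' : ∫ y in (0 : ℝ)..x, ‖onHalfLine (boundState N γ ω e) y‖ ^ 2 =
      ∫ y in (0 : ℝ)..x, profile N γ ω y ^ 2 := by
    refine intervalIntegral.integral_congr fun y hy => ?_
    rw [uIcc_of_le hx] at hy
    simp only [onHalfLine_boundState e hy.1, Complex.norm_real, Real.norm_eq_abs, sq_abs]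
  rw [slope, edgeMass_boundState hω, hi', hi]
  simp only [mul_zero, zero_add]
  ring

theorem integral_square_boundState (hω : 0 < ω) (e : Fin N) :
    ∫ x in Ioi (0 : ℝ), ‖-((√ω * Real.tanh (√ω * x + Real.artanh (γ / (N * √ω))) : ℝ) : ℂ)
        * profile N γ ω x + (slope √ω (onHalfLine (boundState N γ ω e)) x : ℂ)
        * onHalfLine (boundState N γ ω e) x‖ ^ 2 = 0 := by
  refine (setIntegral_congr_fun measurableSet_Ioi fun x hx => ?_).trans
    (integral_zero ℝ ℝ)
  have hx0 : 0 ≤ x := le_of_lt (mem_Ioi.1 hx)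
  simp only [slope_boundState hω e hx0, onHalfLine_boundState e hx0]
  rw [neg_mul, neg_add_cancel, norm_zero]
  norm_num

end Profile

/-! ### Functions on the star graph -/

section Graph

variable {N : ℕ}

theorem IsH1Pair.hasL2WeakDeriv {f g : ℝ → ℂ} (h : IsH1Pair f g) : HasL2WeakDeriv f g :=
  ⟨h.memLp_deriv, isWeakDeriv_of_eq_primitive h.memLp_deriv h.eq_primitive⟩

theorem IsH1Pair.memH1HalfLine {f g : ℝ → ℂ} (h : IsH1Pair f g) : MemH1HalfLine f :=
  ⟨h.memLp, g, h.hasL2WeakDeriv⟩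

theorem IsH1Pair.const_mul {f g : ℝ → ℂ} (h : IsH1Pair f g) (c : ℂ) :
    IsH1Pair (fun x => c * f x) (fun x => c * g x) where
  continuous := h.continuous.const_mul c
  memLp := h.memLp.const_mul c
  memLp_deriv := h.memLp_deriv.const_mul c
  eq_primitive := fun x hx => by
    rw [intervalIntegral.integral_const_mul, h.eq_primitive x hx]
    ring

theorem IsH1Pair.integral_weakDeriv {f g : ℝ → ℂ} (h : IsH1Pair f g) :
    ∫ x in Ioi (0 : ℝ), ‖weakDeriv f x‖ ^ 2 = ∫ x in Ioi (0 : ℝ), ‖g x‖ ^ 2 := by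
  refine integral_congr_ae ?_
  filter_upwards [weakDeriv_ae_eq h.hasL2WeakDeriv] with x hx
  rw [hx]

theorem MemH1.isH1Pair {u : Fun N} (hu : MemH1 u) (e : Fin N) :
    IsH1Pair (onHalfLine (u e)) (weakDeriv (onHalfLine (u e))) where
  continuous := (hu.1.1 e).comp continuous_real_toNNReal
  memLp := (hu.2 e).1
  memLp_deriv := (hasL2WeakDeriv_weakDeriv (hu.2 e)).1
  eq_primitive := eq_primitive_of_isWeakDeriv ((hu.1.1 e).comp continuous_real_toNNReal)
    (hasL2WeakDeriv_weakDeriv (hu.2 e))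

/-- Multiplication of a function on the graph by a constant. -/
def scale (c : ℂ) (u : Fun N) : Fun N := fun e x => c * u e x

theorem onHalfLine_scale (c : ℂ) (u : Fun N) (e : Fin N) :
    onHalfLine (scale c u e) = fun x => c * onHalfLine (u e) x := rfl

theorem MemH1.scale {u : Fun N} (hu : MemH1 u) (c : ℂ) : MemH1 (scale c u) :=
  ⟨⟨fun e => (hu.1.1 e).const_mul c, fun e e' => by
    simp only [StarGraph.scale, hu.1.2 e e']⟩, fun e => ((hu.isH1Pair e).const_mul c).memH1HalfLine⟩

theorem mass_scale (c : ℂ) (u : Fun N) : mass (scale c u) = ‖c‖ ^ 2 * mass u := by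
  simp only [mass, onHalfLine_scale, norm_mul, mul_pow, integral_const_mul, Finset.mul_sum]

theorem quartic_scale (c : ℂ) (u : Fun N) : quartic (scale c u) = ‖c‖ ^ 4 * quartic u := by
  simp only [quartic, onHalfLine_scale, norm_mul, mul_pow, integral_const_mul, Finset.mul_sum]

theorem interaction_scale (c d : ℂ) (u v : Fun N) :
    interaction (scale c u) (scale d v) = ‖c‖ ^ 2 * ‖d‖ ^ 2 * interaction u v := by
  simp only [interaction, onHalfLine_scale, Finset.mul_sum, ← integral_const_mul, norm_mul]
  refine Finset.sum_congr rfl fun e _ => ?_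
  congr 1
  ext x
  ring

theorem kinetic_scale (c : ℂ) {u : Fun N} (hu : MemH1 u) :
    kinetic (scale c u) = ‖c‖ ^ 2 * kinetic u := by
  simp only [kinetic, Finset.mul_sum]
  refine Finset.sum_congr rfl fun e _ => ?_
  rw [onHalfLine_scale, ((hu.isH1Pair e).const_mul c).integral_weakDeriv, ← integral_const_mul]
  simp only [norm_mul, mul_pow]

theorem scale_scale (c d : ℂ) (u : Fun N) : scale c (scale d u) = scale (c * d) u := by
  funext e x
  simp only [scale, mul_assoc]

theorem scale_one (u : Fun N) : scale 1 u = u := by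
  funext e x
  simp only [scale, one_mul]

theorem scale_boundState (γ ω : ℝ) (c : ℂ) :
    scale c (boundState N γ ω) = scaledProfile N γ ω c := by
  funext e x
  simp only [scale, boundState, scaledProfile, one_mul]

/-- Pointwise 2|u|²|v|² ≤ |u|⁴ + |v|⁴; this gives the coupling defect its sign. -/
theorem interaction_le {u v : Fun N} (hu : MemH1 u) (hv : MemH1 v) :
    interaction u v ≤ (quartic u + quartic v) / 2 := by
  rw [interaction, quartic, quartic, ← Finset.sum_add_distrib, Finset.sum_div]
  refine Finset.sum_le_sum fun e _ => ?_
  have i1 := (hu.isH1Pair e).integrable_norm_pow_four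
  have i2 := (hv.isH1Pair e).integrable_norm_pow_four
  rw [← integral_add i1 i2, ← integral_div]
  refine integral_mono_of_nonneg (ae_of_all _ fun x => by positivity)
    ((i1.add i2).div_const 2) (ae_of_all _ fun x => ?_)
  simp only [norm_mul]
  nlinarith [sq_nonneg (‖onHalfLine (u e) x‖ ^ 2 - ‖onHalfLine (v e) x‖ ^ 2)]

theorem interaction_self (u : Fun N) : interaction u u = quartic u := by
  simp only [interaction, quartic, norm_mul]
  refine Finset.sum_congr rfl fun e _ => ?_
  congr 1
  ext x
  ring

theorem mass_eq_sum_edgeMass (u : Fun N) : mass u = ∑ e, edgeMass (onHalfLine (u e)) := rfl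

theorem edgeMass_nonneg (f : ℝ → ℂ) : 0 ≤ edgeMass f :=
  integral_nonneg fun x => by positivity

/-- One edge carries at most the total mass Nn, so 6l > (N + 2)n suffices; the assumption gives 6l ≥
(3/2)(N + 2)n. -/
theorem coefficient_pos {l n : ℝ} {u : Fun N} (hn0 : 0 < n) (hn : mass u = N * n)
    (hl : n / 2 + N * n / 4 ≤ l) (e : Fin N) :
    0 < l / 2 - (edgeMass (onHalfLine (u e)) + 2 * n) / 12 := by
  have h1 : edgeMass (onHalfLine (u e)) ≤ N * n := by
    rw [← hn, mass_eq_sum_edgeMass]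
    exact Finset.single_le_sum (f := fun e => edgeMass (onHalfLine (u e)))
      (fun e _ => edgeMass_nonneg _) (Finset.mem_univ e)
  have h2 : 0 ≤ (N : ℝ) * n := by positivity
  linarith

variable [NeZero N]

/-- The energy of the scalar cubic equation with `δ` coupling at the vertex. -/
noncomputable def scalarEnergy (γ : ℝ) (u : Fun N) : ℝ :=
  kinetic u - γ * ‖u 0 0‖ ^ 2 - 1 / 2 * quartic u

/-- The least energy of the scalar problem with frequency `l ^ 2` and mass `n` on each edge. -/
noncomputable def scalarGroundEnergy (N : ℕ) (l n : ℝ) : ℝ :=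
  N * (-l ^ 2 * n + l * n ^ 2 / 2 - n ^ 3 / 12)

/-- The energy becomes its minimum plus terms measuring the failure of f' = -wf and of equal edge
masses. The derivative g is left free so that the bound state can be fed in with its explicit one.
-/
theorem scalarEnergy_eq {γ l n : ℝ} {u : Fun N} (hu : MemH1 u) {g : Fin N → ℝ → ℂ}
    (hg : ∀ e, IsH1Pair (onHalfLine (u e)) (g e))
    (hn : mass u = N * n) (hγ : γ = N * (l - n / 2)) :
    scalarEnergy γ u = (∑ e,
      ((∫ x in Ioi (0 : ℝ), ‖g e x
          + (slope l (onHalfLine (u e)) x : ℂ) * onHalfLine (u e) x‖ ^ 2)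
        + (l / 2 - (edgeMass (onHalfLine (u e)) + 2 * n) / 12)
          * (edgeMass (onHalfLine (u e)) - n) ^ 2)) + scalarGroundEnergy N l n := by
  set μ : Fin N → ℝ := fun e => edgeMass (onHalfLine (u e)) with hμ
  set k : ℝ := ‖u 0 0‖ ^ 2 with hk
  set I : Fin N → ℝ := fun e => ∫ x in Ioi (0 : ℝ), ‖g e x
          + (slope l (onHalfLine (u e)) x : ℂ) * onHalfLine (u e) x‖ ^ 2 with hI
  have hid : ∀ e, (∫ x in Ioi (0 : ℝ), ‖weakDeriv (onHalfLine (u e)) x‖ ^ 2)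
      - 1 / 2 * ∫ x in Ioi (0 : ℝ), ‖onHalfLine (u e) x‖ ^ 4 =
      I e + (l - μ e / 2) * k + 2 / 3 * ((l - μ e / 2) ^ 3 - l ^ 3) := by
    intro e
    have h0 : onHalfLine (u e) 0 = u 0 0 := by
      rw [onHalfLine, Real.toNNReal_zero, hu.1.2 e 0]
    rw [(hg e).integral_weakDeriv, (hg e).energy_identity l, h0]
  have hs : ∑ e, μ e = N * n := by rw [← hn]; rfl
  have e1 : scalarEnergy γ u =
      (∑ e, (I e + (l - μ e / 2) * k + 2 / 3 * ((l - μ e / 2) ^ 3 - l ^ 3))) - γ * k := by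
    rw [← Finset.sum_congr rfl fun e _ => hid e, Finset.sum_sub_distrib, ← Finset.mul_sum,
      scalarEnergy, kinetic, quartic]
    ring
  -- Exact expansion of the cubic in the edge mass at n: the linear term sums to zero, and N(l -
  -- n/2)k cancels against γk.
  have e2 : ∀ e, I e + (l - μ e / 2) * k + 2 / 3 * ((l - μ e / 2) ^ 3 - l ^ 3) =
      (I e + (l / 2 - (μ e + 2 * n) / 12) * (μ e - n) ^ 2)
        + (μ e - n) * (-k / 2 - l ^ 2 + l * n - n ^ 2 / 4)
        + ((l - n / 2) * k + (-l ^ 2 * n + l * n ^ 2 / 2 - n ^ 3 / 12)) := by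
    intro e
    ring
  rw [e1, Finset.sum_congr rfl fun e _ => e2 e, Finset.sum_add_distrib, Finset.sum_add_distrib,
    ← Finset.sum_mul, Finset.sum_sub_distrib, hs, scalarGroundEnergy, hγ]
  simp only [Finset.sum_const, Finset.card_univ, Fintype.card_fin, nsmul_eq_mul]
  ring

theorem scalarGroundEnergy_le {γ l n : ℝ} {u : Fun N} (hu : MemH1 u) (hn0 : 0 < n)
    (hn : mass u = N * n) (hγ : γ = N * (l - n / 2)) (hl : n / 2 + N * n / 4 ≤ l) :
    scalarGroundEnergy N l n ≤ scalarEnergy γ u := by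
  rw [scalarEnergy_eq hu hu.isH1Pair hn hγ]
  refine le_add_of_nonneg_left (Finset.sum_nonneg fun e _ => add_nonneg ?_ ?_)
  · exact integral_nonneg fun x => by positivity
  · exact mul_nonneg (coefficient_pos hn0 hn hl e).le (sq_nonneg _)

theorem eq_of_scalarEnergy_le {γ l n : ℝ} {u : Fun N} (hu : MemH1 u) (hn0 : 0 < n)
    (hn : mass u = N * n) (hγ : γ = N * (l - n / 2)) (hl : n / 2 + N * n / 4 ≤ l)
    (hE : scalarEnergy γ u ≤ scalarGroundEnergy N l n) (e : Fin N) :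
    edgeMass (onHalfLine (u e)) = n ∧
      ∫ x in Ioi (0 : ℝ), ‖weakDeriv (onHalfLine (u e)) x
        + (slope l (onHalfLine (u e)) x : ℂ) * onHalfLine (u e) x‖ ^ 2 = 0 := by
  rw [scalarEnergy_eq hu hu.isH1Pair hn hγ] at hE
  have p1 : ∀ e, 0 ≤ ∫ x in Ioi (0 : ℝ), ‖weakDeriv (onHalfLine (u e)) x
        + (slope l (onHalfLine (u e)) x : ℂ) * onHalfLine (u e) x‖ ^ 2 :=
    fun e => integral_nonneg fun x => by positivity
  have p2 : ∀ e, 0 ≤ (l / 2 - (edgeMass (onHalfLine (u e)) + 2 * n) / 12)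
          * (edgeMass (onHalfLine (u e)) - n) ^ 2 :=
    fun e => mul_nonneg (coefficient_pos hn0 hn hl e).le (sq_nonneg _)
  have hz := (Finset.sum_eq_zero_iff_of_nonneg fun e _ => add_nonneg (p1 e) (p2 e)).1
    (le_antisymm (by linarith) (Finset.sum_nonneg fun e _ => add_nonneg (p1 e) (p2 e)))
    e (Finset.mem_univ e)
  have hz2 := (add_eq_zero_iff_of_nonneg (p1 e) (p2 e)).1 hz
  refine ⟨?_, hz2.1⟩
  have := (mul_eq_zero.1 hz2.2).resolve_left (coefficient_pos hn0 hn hl e).ne'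
  exact sub_eq_zero.1 (pow_eq_zero_iff two_ne_zero |>.1 this)

/-- The two linear relations rewrite a‖p‖⁴ and c‖q‖⁴ as ‖p‖² and ‖q‖² minus b‖p‖²‖q‖², so each
scalar energy gets coefficient one in its quartic part and the surplus joins the interaction. -/
theorem energy_scale (γ a b c : ℝ) (p q : ℂ) {u v : Fun N} (hu : MemH1 u) (hv : MemH1 v)
    (h1 : a * ‖p‖ ^ 2 + b * ‖q‖ ^ 2 = 1) (h2 : b * ‖p‖ ^ 2 + c * ‖q‖ ^ 2 = 1) :
    energy γ a b c (scale p u) (scale q v) =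
      ‖p‖ ^ 2 * scalarEnergy γ u + ‖q‖ ^ 2 * scalarEnergy γ v
        + b * ‖p‖ ^ 2 * ‖q‖ ^ 2 * ((quartic u + quartic v) / 2 - interaction u v) := by
  rw [energy, kinetic_scale p hu, kinetic_scale q hv, quartic_scale, quartic_scale,
    interaction_scale]
  simp only [scale, norm_mul, scalarEnergy]
  linear_combination (-(1 / 2) * ‖p‖ ^ 2 * quartic u) * h1
    + (-(1 / 2) * ‖q‖ ^ 2 * quartic v) * h2

end Graph

/-! ### The bound state -/

section BoundState

variable {N : ℕ} {γ ω : ℝ}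

theorem memH1_boundState (hω : 0 < ω) : MemH1 (boundState N γ ω) :=
  ⟨⟨fun e => by
    have := continuous_profile (N := N) (γ := γ) (ω := ω)
    show Continuous fun x : ℝ≥0 => (1 : ℂ) * (profile N γ ω (x : ℝ) : ℂ)
    fun_prop, fun _ _ => rfl⟩, fun e => (isH1Pair_boundState hω e).memH1HalfLine⟩

variable [NeZero N]

theorem sqrt_mul_tanh_artanh (hγ : 0 < γ) (hω : γ ^ 2 / (N : ℝ) ^ 2 < ω) :
    √ω * Real.tanh (Real.artanh (γ / (N * √ω))) = γ / N := by
  have hN : (0 : ℝ) < N := Nat.cast_pos.2 (NeZero.pos N)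
  have hl : γ / N < √ω := by
    rw [← div_pow] at hω
    exact Real.lt_sqrt_of_sq_lt hω
  have hl0 : 0 < √ω := (by positivity : 0 < γ / N).trans hl
  have h1 : γ / (N * √ω) < 1 := by
    rw [← div_div, div_lt_one hl0]
    exact hl
  have h2 : 0 < γ / (N * √ω) := by positivity
  rw [Real.tanh_artanh ⟨by linarith, h1⟩]
  field_simp

theorem edgeMass_boundState_eq (hγ : 0 < γ) (hω : γ ^ 2 / (N : ℝ) ^ 2 < ω) (e : Fin N) :
    edgeMass (onHalfLine (boundState N γ ω e)) = 2 * (√ω - γ / N) := by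
  have hω0 : 0 < ω := lt_of_le_of_lt (by positivity) hω
  rw [edgeMass_boundState hω0, mul_assoc, mul_sub, sqrt_mul_tanh_artanh hγ hω, mul_one]

theorem mass_boundState (hγ : 0 < γ) (hω : γ ^ 2 / (N : ℝ) ^ 2 < ω) :
    mass (boundState N γ ω) = N * (2 * (√ω - γ / N)) := by
  simp only [mass_eq_sum_edgeMass, edgeMass_boundState_eq hγ hω, Finset.sum_const,
    Finset.card_univ, Fintype.card_fin, nsmul_eq_mul]

theorem scalarEnergy_boundState (hγ : 0 < γ) (hω : γ ^ 2 / (N : ℝ) ^ 2 < ω) :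
    scalarEnergy γ (boundState N γ ω) = scalarGroundEnergy N √ω (2 * (√ω - γ / N)) := by
  have hω0 : 0 < ω := lt_of_le_of_lt (by positivity) hω
  have hN : (N : ℝ) ≠ 0 := Nat.cast_ne_zero.2 (NeZero.ne N)
  rw [scalarEnergy_eq (l := √ω) (n := 2 * (√ω - γ / N)) (memH1_boundState hω0)
    (isH1Pair_boundState hω0) (mass_boundState hγ hω)
    (by field_simp; ring)]
  simp only [integral_square_boundState hω0, edgeMass_boundState_eq hγ hω]
  simp

/-- The scalar ground state is unique up to a phase. -/
theorem exists_phase_of_scalarEnergy_le (hγ : 0 < γ) (hω : γ ^ 2 / (N : ℝ) ^ 2 < ω)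
    (hl : (√ω - γ / N) + N * (√ω - γ / N) / 2 ≤ √ω) {u : Fun N} (hu : MemH1 u)
    (hn : mass u = N * (2 * (√ω - γ / N)))
    (hE : scalarEnergy γ u ≤ scalarGroundEnergy N √ω (2 * (√ω - γ / N))) :
    ∃ θ : ℝ, u = scale (Complex.exp (θ * Complex.I)) (boundState N γ ω) := by
  have hω0 : 0 < ω := lt_of_le_of_lt (by positivity) hω
  have hN : (N : ℝ) ≠ 0 := Nat.cast_ne_zero.2 (NeZero.ne N)
  have hn0 : 0 < √ω - γ / N := by
    rw [← div_pow] at hω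
    exact sub_pos.2 (Real.lt_sqrt_of_sq_lt hω)
  set t := Real.artanh (γ / (N * √ω)) with ht
  have hlt := sqrt_mul_tanh_artanh hγ hω
  rw [← ht] at hlt
  have key := fun e => eq_of_scalarEnergy_le hu (by positivity) hn
    (by field_simp; ring) (by linarith) hE e
  have hp := fun e => (hu.isH1Pair e).eq_profile_of_integral_eq_zero (l := √ω) (t := t)
    (by rw [(key e).1, hlt]; ring) (key e).2
  have h0 : ∀ e, onHalfLine (u e) 0 = u 0 0 := fun e => by
    rw [onHalfLine, Real.toNNReal_zero, hu.1.2 e 0]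
  have hc : Real.cosh t ≠ 0 := (Real.cosh_pos t).ne'
  -- From |f(0)|² = 2l²(1 - tanh² t) = 2ω/cosh² t.
  have hnorm : ‖u 0 0‖ * Real.cosh t = √(2 * ω) := by
    rw [← h0 0]
    rw [← Real.sqrt_sq (mul_nonneg (norm_nonneg _) (Real.cosh_pos t).le), mul_pow, (hp 0).1,
      Real.tanh_eq_sinh_div_cosh]
    congr 1
    field_simp
    rw [Real.sq_sqrt hω0.le]
    linear_combination ω * Real.cosh_sq t
  -- The vertex value is common to all edges, so its argument is the phase on each of them.
  refine ⟨(u 0 0).arg, ?_⟩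
  funext e x
  have hx := (hp e).2 x x.2
  rw [h0, onHalfLine, Real.toNNReal_coe, ← Complex.norm_mul_exp_arg_mul_I (u 0 0)] at hx
  have hcx : (Real.cosh (√ω * x + t) : ℂ) ≠ 0 :=
    Complex.ofReal_ne_zero.2 (Real.cosh_pos _).ne'
  simp only [scale, boundState, scaledProfile, one_mul, profile, sech, ← ht, ← hnorm]
  push_cast at hx hcx ⊢
  field_simp
  linear_combination hx

end BoundState

/-! ### The coupled problem -/

section Coupled

variable {N : ℕ} {γ ω a b c : ℝ} {p q : ℂ}

theorem scale_inv_scale {p : ℂ} (hp : p ≠ 0) (u : Fun N) : scale p (scale p⁻¹ u) = u := by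
  rw [scale_scale, mul_inv_cancel₀ hp, scale_one]

theorem mass_scale_inv {p : ℂ} (hp : p ≠ 0) {u : Fun N} {M : ℝ} (h : mass u = ‖p‖ ^ 2 * M) :
    mass (scale p⁻¹ u) = M := by
  have : ‖p‖ ≠ 0 := norm_ne_zero_iff.2 hp
  rw [mass_scale, h, norm_inv]
  field_simp

variable [NeZero N]

/-- Reduction of the coupled energy to the scalar one. -/
theorem scalarEnergy_add_le_energy (hb : 0 < b) (hp : p ≠ 0) (hq : q ≠ 0)
    (h1 : a * ‖p‖ ^ 2 + b * ‖q‖ ^ 2 = 1) (h2 : b * ‖p‖ ^ 2 + c * ‖q‖ ^ 2 = 1)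
    {u v : Fun N} (hu : MemH1 u) (hv : MemH1 v) :
    ‖p‖ ^ 2 * scalarEnergy γ (scale p⁻¹ u) + ‖q‖ ^ 2 * scalarEnergy γ (scale q⁻¹ v) ≤
      energy γ a b c u v := by
  have := energy_scale γ a b c p q (hu.scale p⁻¹) (hv.scale q⁻¹) h1 h2
  rw [scale_inv_scale hp, scale_inv_scale hq] at this
  rw [this]
  have hi := interaction_le (hu.scale p⁻¹) (hv.scale q⁻¹)
  have : 0 ≤ b * ‖p‖ ^ 2 * ‖q‖ ^ 2 := by positivity
  linarith [mul_nonneg this (sub_nonneg.2 hi)]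

theorem energy_scaledProfile (hγ : 0 < γ) (hω : γ ^ 2 / (N : ℝ) ^ 2 < ω)
    (h1 : a * ‖p‖ ^ 2 + b * ‖q‖ ^ 2 = 1) (h2 : b * ‖p‖ ^ 2 + c * ‖q‖ ^ 2 = 1) :
    energy γ a b c (scaledProfile N γ ω p) (scaledProfile N γ ω q) =
      (‖p‖ ^ 2 + ‖q‖ ^ 2) * scalarGroundEnergy N √ω (2 * (√ω - γ / N)) := by
  have hω0 : 0 < ω := lt_of_le_of_lt (by positivity) hω
  rw [← scale_boundState, ← scale_boundState,
    energy_scale γ a b c p q (memH1_boundState hω0) (memH1_boundState hω0) h1 h2,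
    interaction_self, scalarEnergy_boundState hγ hω]
  ring

theorem scaledProfile_mem_admissible (hγ : 0 < γ) (hω : γ ^ 2 / (N : ℝ) ^ 2 < ω) :
    (scaledProfile N γ ω p, scaledProfile N γ ω q) ∈
      admissible N (‖p‖ ^ 2 * (N * (2 * (√ω - γ / N)))) (‖q‖ ^ 2 * (N * (2 * (√ω - γ / N)))) := by
  have hω0 : 0 < ω := lt_of_le_of_lt (by positivity) hω
  rw [← scale_boundState, ← scale_boundState]
  refine ⟨(memH1_boundState hω0).scale p, (memH1_boundState hω0).scale q, ?_, ?_⟩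
  · rw [mass_scale, mass_boundState hγ hω]
  · rw [mass_scale, mass_boundState hγ hω]


/-- The ground states for masses that are proportional to those of a synchronized bound state. -/
theorem groundStates_eq (hb : 0 < b) (hp : p ≠ 0) (hq : q ≠ 0) (hγ : 0 < γ)
    (hω : γ ^ 2 / (N : ℝ) ^ 2 < ω)
    (hl : (√ω - γ / N) + N * (√ω - γ / N) / 2 ≤ √ω)
    (h1 : a * ‖p‖ ^ 2 + b * ‖q‖ ^ 2 = 1) (h2 : b * ‖p‖ ^ 2 + c * ‖q‖ ^ 2 = 1) :
    groundStates N γ a b c (‖p‖ ^ 2 * (N * (2 * (√ω - γ / N))))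
      (‖q‖ ^ 2 * (N * (2 * (√ω - γ / N)))) =
      {P | ∃ θ₁ θ₂ : ℝ, P = (scaledProfile N γ ω (Complex.exp (θ₁ * Complex.I) * p),
        scaledProfile N γ ω (Complex.exp (θ₂ * Complex.I) * q))} := by
  have hn0 : 0 < √ω - γ / N := by
    rw [← div_pow] at hω
    exact sub_pos.2 (Real.lt_sqrt_of_sq_lt hω)
  have hN : (N : ℝ) ≠ 0 := Nat.cast_ne_zero.2 (NeZero.ne N)
  have hp2 : 0 < ‖p‖ ^ 2 := by positivity
  have hq2 : 0 < ‖q‖ ^ 2 := by positivity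
  set n := √ω - γ / N with hn
  set K := scalarGroundEnergy N √ω (2 * n) with hK
  have lower : ∀ w : Fun N, MemH1 w → mass w = N * (2 * n) → K ≤ scalarEnergy γ w :=
    fun w hw hm => scalarGroundEnergy_le hw (by positivity) hm (by rw [hn]; field_simp; ring)
      (by linarith)
  have bound : ∀ P ∈ admissible N (‖p‖ ^ 2 * (N * (2 * n))) (‖q‖ ^ 2 * (N * (2 * n))),
      (‖p‖ ^ 2 + ‖q‖ ^ 2) * K ≤ energy γ a b c P.1 P.2 := by
    rintro ⟨u, v⟩ ⟨hu, hv, mu, mv⟩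
    have e1 := lower _ (hu.scale p⁻¹) (mass_scale_inv hp mu)
    have e2 := lower _ (hv.scale q⁻¹) (mass_scale_inv hq mv)
    have e3 := scalarEnergy_add_le_energy (γ := γ) hb hp hq h1 h2 hu hv
    nlinarith [mul_le_mul_of_nonneg_left e1 hp2.le, mul_le_mul_of_nonneg_left e2 hq2.le]
  have hmin : minEnergy N γ a b c (‖p‖ ^ 2 * (N * (2 * n))) (‖q‖ ^ 2 * (N * (2 * n))) =
      (((‖p‖ ^ 2 + ‖q‖ ^ 2) * K : ℝ) : EReal) := by
    refine le_antisymm (sInf_le ⟨_, scaledProfile_mem_admissible (p := p) (q := q) hγ hω, ?_⟩)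
      (le_sInf ?_)
    · simp only [energy_scaledProfile hγ hω h1 h2]
      rfl
    · rintro _ ⟨P, hP, rfl⟩
      exact EReal.coe_le_coe_iff.2 (bound P hP)
  ext ⟨u, v⟩
  constructor
  · rintro ⟨⟨hu, hv, mu, mv⟩, hE⟩
    rw [hmin, EReal.coe_eq_coe_iff] at hE
    simp only at hu hv mu mv hE
    have e1 := lower _ (hu.scale p⁻¹) (mass_scale_inv hp mu)
    have e2 := lower _ (hv.scale q⁻¹) (mass_scale_inv hq mv)
    have e3 := scalarEnergy_add_le_energy (γ := γ) hb hp hq h1 h2 hu hv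
    -- The weighted sum of the two scalar energies is at most (‖p‖² + ‖q‖²)K while each is at least
    -- K, so neither can exceed K.
    have f1 : scalarEnergy γ (scale p⁻¹ u) ≤ K := by
      refine le_of_mul_le_mul_left ?_ hp2
      nlinarith [mul_le_mul_of_nonneg_left e2 hq2.le]
    have f2 : scalarEnergy γ (scale q⁻¹ v) ≤ K := by
      refine le_of_mul_le_mul_left ?_ hq2
      nlinarith [mul_le_mul_of_nonneg_left e1 hp2.le]
    obtain ⟨θ₁, hθ₁⟩ := exists_phase_of_scalarEnergy_le hγ hω hl (hu.scale p⁻¹)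
      (mass_scale_inv hp mu) f1
    obtain ⟨θ₂, hθ₂⟩ := exists_phase_of_scalarEnergy_le hγ hω hl (hv.scale q⁻¹)
      (mass_scale_inv hq mv) f2
    refine ⟨θ₁, θ₂, ?_⟩
    rw [← scale_inv_scale hp u, ← scale_inv_scale hq v, hθ₁, hθ₂, scale_scale, scale_scale,
      scale_boundState, scale_boundState, mul_comm p, mul_comm q]
  · rintro ⟨θ₁, θ₂, hP⟩
    have np : ‖Complex.exp (θ₁ * Complex.I) * p‖ = ‖p‖ := by
      rw [norm_mul, Complex.norm_exp_ofReal_mul_I, one_mul]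
    have nq : ‖Complex.exp (θ₂ * Complex.I) * q‖ = ‖q‖ := by
      rw [norm_mul, Complex.norm_exp_ofReal_mul_I, one_mul]
    have hadm := scaledProfile_mem_admissible (N := N) (p := Complex.exp (θ₁ * Complex.I) * p)
      (q := Complex.exp (θ₂ * Complex.I) * q) hγ hω
    have hen := energy_scaledProfile (N := N) (a := a) (b := b) (c := c)
      (p := Complex.exp (θ₁ * Complex.I) * p) (q := Complex.exp (θ₂ * Complex.I) * q) hγ hω
      (by rw [np, nq, h1]) (by rw [np, nq, h2])
    rw [np, nq] at hadm hen
    rw [hP]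
    refine ⟨hadm, ?_⟩
    rw [hmin, hen]

end Coupled

end StarGraph

theorem theorem2 (N : ℕ) [NeZero N] (hN : 2 ≤ N) (a b c γ ω : ℝ)
    (habc : (0 < b ∧ b < min a c) ∨ (0 < a ∧ 0 < c ∧ max a c < b))
    (hγ : 0 < γ) (hω : γ ^ 2 / (N : ℝ) ^ 2 < ω)
    (hmass : (N : ℝ) * √ω - γ ≤ 2 * γ / N) :
    StarGraph.groundStates N γ a b c
        (StarGraph.alphaMass N γ ω a b c) (StarGraph.betaMass N γ ω a b c) =
      {p | ∃ θ₁ θ₂ : ℝ, p =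
        (StarGraph.scaledProfile N γ ω
            (Complex.exp (θ₁ * Complex.I) * (√((b - c) / (b ^ 2 - a * c)) : ℝ)),
          StarGraph.scaledProfile N γ ω
            (Complex.exp (θ₂ * Complex.I) * (√((b - a) / (b ^ 2 - a * c)) : ℝ)))} := by
  have hN0 : (0 : ℝ) < N := Nat.cast_pos.2 (NeZero.pos N)
  -- In each regime b - a, b - c and b² - ac share a sign: negative for small b, positive for large
  -- b.
  obtain ⟨hb, hD, hA, hB⟩ : 0 < b ∧ b ^ 2 - a * c ≠ 0 ∧ 0 < (b - c) / (b ^ 2 - a * c) ∧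
      0 < (b - a) / (b ^ 2 - a * c) := by
    rcases habc with ⟨hb, h⟩ | ⟨ha, hc, h⟩
    · obtain ⟨h1, h2⟩ := lt_min_iff.1 h
      have hD : b ^ 2 - a * c < 0 := by nlinarith
      exact ⟨hb, hD.ne, div_pos_of_neg_of_neg (by linarith) hD,
        div_pos_of_neg_of_neg (by linarith) hD⟩
    · obtain ⟨h1, h2⟩ := max_lt_iff.1 h
      have hD : 0 < b ^ 2 - a * c := by nlinarith
      exact ⟨by linarith, hD.ne', div_pos (by linarith) hD, div_pos (by linarith) hD⟩
  set A := (b - c) / (b ^ 2 - a * c) with hAdef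
  set B := (b - a) / (b ^ 2 - a * c) with hBdef
  have nA : ‖((√A : ℝ) : ℂ)‖ ^ 2 = A := by
    rw [Complex.norm_real, Real.norm_eq_abs, sq_abs, Real.sq_sqrt hA.le]
  have nB : ‖((√B : ℝ) : ℂ)‖ ^ 2 = B := by
    rw [Complex.norm_real, Real.norm_eq_abs, sq_abs, Real.sq_sqrt hB.le]
  have key := StarGraph.groundStates_eq (N := N) (γ := γ) (ω := ω) (a := a) (b := b) (c := c)
    (p := ((√A : ℝ) : ℂ)) (q := ((√B : ℝ) : ℂ)) hb
    (Complex.ofReal_ne_zero.2 (Real.sqrt_pos.2 hA).ne')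
    (Complex.ofReal_ne_zero.2 (Real.sqrt_pos.2 hB).ne') hγ hω
    (by
      -- The mass bound in terms of √ω - γ/N; halving it and adding √ω - γ/N gives the required
      -- inequality.
      have : (N : ℝ) * (√ω - γ / N) ≤ 2 * (γ / N) := by
        rw [mul_sub, mul_div_cancel₀ _ hN0.ne', ← mul_div_assoc]
        exact hmass
      linarith)
    (by rw [nA, nB, hAdef, hBdef, mul_div_assoc', mul_div_assoc', ← add_div,
      div_eq_one_iff_eq hD]; ring)
    (by rw [nA, nB, hAdef, hBdef, mul_div_assoc', mul_div_assoc', ← add_div,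
      div_eq_one_iff_eq hD]; ring)
  rw [nA, nB] at key
  rw [← key]
  congr 1
  · rw [StarGraph.alphaMass, hAdef]
    field_simp
  · rw [StarGraph.betaMass, hBdef]
    field_simp
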